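/- Let $G$ be a finite cyclic group and let $L$ be a finitely generated free abelian group on which $G$ acts by group automorphisms. Suppose that the action is free outside the origin, i.e., whenever $g \in G$ and $x \in L$ satisfy $gx = x$, then $g = 1$ or $x = 0$. For $j \ge 0$ let $\Lambda^j L$ denote the $j$-th exterior power of the $\mathbb{Z}$-module $L$, with the diagonal $G$-action $g(x_1 \wedge \dots \wedge x_j) = gx_1 \wedge \dots \wedge gx_j$. Then the Tate cohomology satisfies $$\widehat{H}^i(G;\Lambda^j L) = 0$$ for all integers $i \in \mathbb{Z}$ and $j \ge 0$ for which $i + j$ is odd. -/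

import Mathlib

/-- The `j`-th exterior power `Λʲ V` of a `k`-linear representation of `G` on `V`, with the
diagonal action `g • (v₁ ∧ ⋯ ∧ vⱼ) = (g • v₁) ∧ ⋯ ∧ (g • vⱼ)`. -/
noncomputable def Representation.exteriorPower {k G V : Type*} [CommRing k] [Monoid G]
    [AddCommGroup V] [Module k V] (ρ : Representation k G V) (j : ℕ) :
    Representation k G (⋀[k]^j V) where
  toFun g := _root_.exteriorPower.map j (ρ g)
  map_one' := by
    rw [map_one]
    exact _root_.exteriorPower.map_id
  map_mul' g h := by
    rw [map_mul, Module.End.mul_eq_comp, Module.End.mul_eq_comp, _root_.exteriorPower.map_comp]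

theorem Representation.exteriorPower_apply_ιMulti {k G V : Type*} [CommRing k] [Monoid G]
    [AddCommGroup V] [Module k V] (ρ : Representation k G V) (j : ℕ) (g : G) (v : Fin j → V) :
    ρ.exteriorPower j g (_root_.exteriorPower.ιMulti k j v) =
      _root_.exteriorPower.ιMulti k j (fun a => ρ g (v a)) :=
  _root_.exteriorPower.map_apply_ιMulti (ρ g) v

/-! Over a cyclic group of order `m` generated by `t`, Tate cohomology is 2-periodic. So it suffices
to know `ker N / im (t - 1)` for `j` even and `ker (t - 1) / im N` for `j` odd, where `N = 1 + t +
... + t^(m-1)`. This is the predicate `TateVanishes`.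

Reductions. The indices of the Sylow subgroups are coprime, so `TateVanishes.of_prime_powers` allows
`m = p^(k+1)`. Freeness outside the origin makes the norm of the subgroup of order `p` vanish on
`L`. Hence `L` is a module over `ℤ[ζ] = ℤ[x]/Φ_(p^(k+1))`, the ring of integers of a cyclotomic
field. Being finitely generated and torsion-free over a Dedekind domain, `L` is an equivariant
retract of some `ℤ[ζ]^n`, and exterior powers preserve retracts. Finally `ℤ[ζ]^n` is the kernel `K`
of the fibre sums `ℤ^S → ℤ^X`, where `S → X` is the quotient of a free `G`-set by the subgroup of
order `p`, with fibres of size `p`.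

Core. For `a : X → {0, ..., p - 1}` with `∑ a = j`, consider the span of the wedges of basis vectors
indexed by `T ⊆ S` with at most `a x` elements over each `x`, with contraction by the sum of all
coordinates as differential. Sum these complexes over `a`. Below degree `j` the result is exact
(`exists_contractLeft_coordSum_eq`). In degree `0` it is a permutation module, for which `ker N = im
(t - 1)`. In positive degrees it is free up to signs: a nontrivial stabiliser of `T` contains the
subgroup of order `p`, forcing `T` to contain a full fibre, which the bound `a x < p` excludes.
Dimension shifting from degree `0` to degree `j` gives the asserted parity of vanishing for the
cycles in degree `j` (`tateVanishes_koszulCycles`), and `Λ^j K` is a retract of these cycles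
(`tateVanishes_exteriorPower_of_fibreSum`). -/

section

open Finset

set_option linter.unusedSectionVars false

/-- Vanishing of `Ĥ⁻¹` of a cyclic group of order `m` with generator acting by `t`, on the
submodule `Z`. -/
def TateNegVanishes {V : Type*} [AddCommGroup V] (t : Module.End ℤ V) (m : ℕ)
    (Z : Submodule ℤ V) : Prop :=
  ∀ x ∈ Z, (∑ i ∈ range m, t ^ i) x = 0 → ∃ y ∈ Z, t y - y = x

/-- Vanishing of `Ĥ⁰` of a cyclic group of order `m` with generator acting by `t`, on the
submodule `Z`. -/
def TateZeroVanishes {V : Type*} [AddCommGroup V] (t : Module.End ℤ V) (m : ℕ)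
    (Z : Submodule ℤ V) : Prop :=
  ∀ x ∈ Z, t x = x → ∃ y ∈ Z, (∑ i ∈ range m, t ^ i) y = x

/-- Vanishing of the Tate cohomology of a cyclic group in the degrees `i` with `i + j` odd. -/
def TateVanishes {V : Type*} [AddCommGroup V] (t : Module.End ℤ V) (m j : ℕ)
    (Z : Submodule ℤ V) : Prop :=
  (Even j → TateNegVanishes t m Z) ∧ (Odd j → TateZeroVanishes t m Z)

/-! ### Formal properties of the Tate groups of a cyclic group: retracts, dimension shift, Sylow
reduction. -/

section Elementary

variable {V V' : Type*} [AddCommGroup V] [AddCommGroup V'] {t : Module.End ℤ V}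
  {t' : Module.End ℤ V'} {m : ℕ} {Z W : Submodule ℤ V} {Z' : Submodule ℤ V'}

theorem pow_mem_of_stable (hZ : ∀ x ∈ Z, t x ∈ Z) (n : ℕ) {x : V} (hx : x ∈ Z) :
    (t ^ n) x ∈ Z := by
  induction n with
  | zero => simpa
  | succ n ih => rw [pow_succ', Module.End.mul_apply]; exact hZ _ ih

theorem sum_pow_mem_of_stable (hZ : ∀ x ∈ Z, t x ∈ Z) (n : ℕ) {x : V} (hx : x ∈ Z) :
    (∑ i ∈ range n, t ^ i) x ∈ Z := by
  rw [LinearMap.sum_apply]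
  exact Z.sum_mem fun i _ => pow_mem_of_stable hZ i hx

theorem map_pow_of_equivariantOn (hZ : ∀ x ∈ Z, t x ∈ Z) (f : V →ₗ[ℤ] V')
    (hf : ∀ x ∈ Z, f (t x) = t' (f x)) (n : ℕ) {x : V} (hx : x ∈ Z) :
    f ((t ^ n) x) = (t' ^ n) (f x) := by
  induction n with
  | zero => simp
  | succ n ih =>
    rw [pow_succ', pow_succ', Module.End.mul_apply, Module.End.mul_apply,
      hf _ (pow_mem_of_stable hZ n hx), ih]

theorem map_sum_pow_of_equivariantOn (hZ : ∀ x ∈ Z, t x ∈ Z) (f : V →ₗ[ℤ] V')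
    (hf : ∀ x ∈ Z, f (t x) = t' (f x)) (n : ℕ) {x : V} (hx : x ∈ Z) :
    f ((∑ i ∈ range n, t ^ i) x) = (∑ i ∈ range n, t' ^ i) (f x) := by
  simp only [LinearMap.sum_apply, map_sum]
  exact sum_congr rfl fun i _ => map_pow_of_equivariantOn hZ f hf i hx

theorem sub_sum_pow_apply (t : Module.End ℤ V) (n : ℕ) (x : V) :
    t ((∑ i ∈ range n, t ^ i) x) - (∑ i ∈ range n, t ^ i) x = (t ^ n) x - x := by
  have := congrArg (fun f : Module.End ℤ V => f x) (mul_geom_sum t n)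
  simpa [Module.End.mul_apply, LinearMap.sub_apply] using this

theorem sum_pow_sub_apply (t : Module.End ℤ V) (n : ℕ) (x : V) :
    (∑ i ∈ range n, t ^ i) (t x - x) = (t ^ n) x - x := by
  have := congrArg (fun f : Module.End ℤ V => f x) (geom_sum_mul t n)
  simpa only [Module.End.mul_apply, LinearMap.sub_apply, Module.End.one_apply] using this

/-- Vanishing passes to equivariant retracts. -/
theorem TateVanishes.of_retract {j : ℕ} (h : TateVanishes t' m j Z')
    (hZ : ∀ x ∈ Z, t x ∈ Z) (hZ' : ∀ x ∈ Z', t' x ∈ Z')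
    (f : V →ₗ[ℤ] V') (g : V' →ₗ[ℤ] V) (hfZ : ∀ x ∈ Z, f x ∈ Z') (hgZ : ∀ x ∈ Z', g x ∈ Z)
    (hf : ∀ x ∈ Z, f (t x) = t' (f x)) (hg : ∀ x ∈ Z', g (t' x) = t (g x))
    (hgf : ∀ x ∈ Z, g (f x) = x) : TateVanishes t m j Z := by
  refine ⟨fun hj x hx h0 => ?_, fun hj x hx h0 => ?_⟩
  · obtain ⟨y, hy, hyx⟩ := h.1 hj (f x) (hfZ x hx) (by
      rw [← map_sum_pow_of_equivariantOn hZ f hf m hx, h0, map_zero])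
    exact ⟨g y, hgZ y hy, by rw [← hg y hy, ← map_sub, hyx, hgf x hx]⟩
  · obtain ⟨y, hy, hyx⟩ := h.2 hj (f x) (hfZ x hx) (by rw [← hf x hx, h0])
    exact ⟨g y, hgZ y hy, by
      rw [← map_sum_pow_of_equivariantOn hZ' g hg m hy, hyx, hgf x hx]⟩

/-- Dimension shifting along `0 → Z → W → Z' → 0`. -/
theorem TateVanishes.succ {j : ℕ} (h : TateVanishes t' m j Z')
    (hneg : TateNegVanishes t m W) (hzero : TateZeroVanishes t m W)
    (hW : ∀ x ∈ W, t x ∈ W) (htm : ∀ x ∈ W, (t ^ m) x = x)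
    (d : V →ₗ[ℤ] V') (hd : ∀ x ∈ W, d (t x) = t' (d x))
    (hZ : ∀ x, x ∈ Z ↔ x ∈ W ∧ d x = 0)
    (hdW : ∀ x ∈ W, d x ∈ Z') (hsurj : ∀ z ∈ Z', ∃ w ∈ W, d w = z) :
    TateVanishes t m (j + 1) Z := by
  refine ⟨fun hj x hx h0 => ?_, fun hj x hx h0 => ?_⟩
  · have hj' : Odd j := by simpa [Nat.even_add_one] using hj
    obtain ⟨hxW, hdx⟩ := (hZ x).1 hx
    obtain ⟨w, hw, rfl⟩ := hneg x hxW h0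
    rw [map_sub, hd w hw, sub_eq_zero] at hdx
    obtain ⟨z, hz, hzw⟩ := h.2 hj' (d w) (hdW w hw) hdx
    obtain ⟨v, hv, rfl⟩ := hsurj z hz
    -- Here `d w` is the norm of `d v`, so subtracting the norm of `v` turns `w` into a cycle; the
    -- norm of `v` is fixed by `t`, so `t w - w` is unchanged.
    refine ⟨w - (∑ i ∈ range m, t ^ i) v,
      (hZ _).2 ⟨W.sub_mem hw (sum_pow_mem_of_stable hW m hv), ?_⟩, ?_⟩
    · rw [map_sub, map_sum_pow_of_equivariantOn hW d hd m hv, hzw, sub_self]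
    · have := sub_sum_pow_apply t m v
      rw [htm v hv, sub_self, sub_eq_zero] at this
      rw [map_sub, this]; abel
  · have hj' : Even j := by
      rw [← Nat.not_even_iff_odd, Nat.even_add_one, not_not] at hj; exact hj
    obtain ⟨hxW, hdx⟩ := (hZ x).1 hx
    obtain ⟨w, hw, rfl⟩ := hzero x hxW h0
    rw [map_sum_pow_of_equivariantOn hW d hd m hw] at hdx
    obtain ⟨z, hz, hzw⟩ := h.1 hj' (d w) (hdW w hw) hdx
    obtain ⟨v, hv, rfl⟩ := hsurj z hz
    refine ⟨w - (t v - v), (hZ _).2 ⟨W.sub_mem hw (W.sub_mem (hW v hv) hv), ?_⟩, ?_⟩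
    · rw [map_sub, map_sub, hd v hv, hzw, sub_self]
    · rw [map_sub, sum_pow_sub_apply, htm v hv, sub_self, sub_zero]

theorem exists_sub_eq_pow_sub (hZ : ∀ x ∈ Z, t x ∈ Z) (n : ℕ) {x : V} (hx : x ∈ Z) :
    ∃ y ∈ Z, t y - y = (t ^ n) x - x :=
  ⟨_, sum_pow_mem_of_stable hZ n hx, sub_sum_pow_apply t n x⟩

/-- The image of `t - 1` on the submodule `Z`. -/
theorem mem_map_sub_one {x : V} :
    x ∈ Z.map (t - 1) ↔ ∃ y ∈ Z, t y - y = x := by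
  simp [Submodule.mem_map]

theorem sum_pow_mul (t : Module.End ℤ V) (n q : ℕ) :
    ∑ i ∈ range (n * q), t ^ i = (∑ i ∈ range q, (t ^ n) ^ i) * ∑ i ∈ range n, t ^ i := by
  induction q with
  | zero => simp
  | succ q ih =>
    rw [Nat.mul_succ, sum_range_add, ih, sum_range_succ, add_mul]
    congr 1
    rw [mul_sum]
    exact sum_congr rfl fun i _ => by rw [pow_add, pow_mul]

/-- Restriction to a Sylow subgroup followed by transfer is multiplication by its index, and these
indices have greatest common divisor `1`. The proof does this by hand on elements. -/
theorem TateVanishes.of_prime_powers {j : ℕ} (hm : m ≠ 0) (hZ : ∀ x ∈ Z, t x ∈ Z)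
    (h : ∀ p : ℕ, p.Prime → p ∣ m →
      TateVanishes (t ^ (m / p ^ m.factorization p)) (p ^ m.factorization p) j Z) :
    TateVanishes t m j Z := by
  by_cases hm1 : m = 1
  · subst hm1
    exact ⟨fun _ x _ h0 => ⟨0, Z.zero_mem, by simpa using h0.symm⟩,
      fun _ x hx _ => ⟨x, hx, by simp⟩⟩
  have key : ∀ M : Submodule ℤ V, ∀ x : V,
      (∀ p : ℕ, p.Prime → p ∣ m → (m / p ^ m.factorization p : ℕ) • x ∈ M) → x ∈ M := by
    intro M x hx
    -- The integers multiplying `x` into `M` form a principal ideal. A prime dividing its generator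
    -- would divide every index `m / p ^ m.factorization p`, hence `m`, hence its own
    -- prime-to-itself part of `m`.
    let I : Ideal ℤ := M.comap (LinearMap.toSpanSingleton ℤ V x)
    have hI : ∀ a : ℤ, a ∈ I ↔ a • x ∈ M := fun a => by simp [I]
    suffices (1 : ℤ) ∈ I by simpa using (hI 1).1 this
    by_contra hne
    obtain ⟨a, ha⟩ := (IsPrincipalIdealRing.principal I).principal
    have ha' : ¬ IsUnit a := fun hu => hne (by
      rw [ha, Submodule.mem_span_singleton]
      obtain ⟨b, hb⟩ := hu.exists_left_inv
      exact ⟨b, by simpa using hb⟩)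
    have hdiv : ∀ p : ℕ, p.Prime → p ∣ m → a.natAbs ∣ m / p ^ m.factorization p := by
      intro p hp hpm
      have : ((m / p ^ m.factorization p : ℕ) : ℤ) ∈ I := (hI _).2 (by
        rw [natCast_zsmul]; exact hx p hp hpm)
      rw [ha, ← Ideal.span, Ideal.mem_span_singleton] at this
      exact Int.natCast_dvd_natCast.1 (by simpa using this)
    have ha1 : a.natAbs ≠ 1 := fun h => ha' (Int.isUnit_iff_natAbs_eq.2 h)
    obtain ⟨p, hp, hpa⟩ := Nat.exists_prime_and_dvd ha1
    obtain ⟨r, hr, hrm⟩ := Nat.exists_prime_and_dvd hm1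
    have hpm : p ∣ m := (hpa.trans (hdiv r hr hrm)).trans (Nat.div_dvd_of_dvd (Nat.ordProj_dvd m r))
    exact Nat.not_dvd_ordCompl hp hm (hpa.trans (hdiv p hp hpm))
  have hmul : ∀ p : ℕ, (m / p ^ m.factorization p) * p ^ m.factorization p = m := fun p =>
    Nat.div_mul_cancel (Nat.ordProj_dvd m p)
  refine ⟨fun hj x hx h0 => ?_, fun hj x hx h0 => ?_⟩
  · rw [← mem_map_sub_one]
    refine key _ _ fun p hp hpm => ?_
    have hp' := (h p hp hpm).1 hj
    rw [← hmul p, sum_pow_mul, Module.End.mul_apply] at h0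
    obtain ⟨y, hy, hyx⟩ := hp' _ (sum_pow_mem_of_stable hZ _ hx) h0
    set n := m / p ^ m.factorization p
    -- Modulo the image of `t - 1`, the partial norm of `x` is `n • x`. It also equals `t ^ n y -
    -- y`, which lies in that image.
    have h2 : (n • x : V) = (∑ i ∈ range n, t ^ i) x - ∑ i ∈ range n, ((t ^ i) x - x) := by
      simp [LinearMap.sum_apply]
    rw [h2]
    refine Submodule.sub_mem _ ?_ (Submodule.sum_mem _ fun i _ =>
      mem_map_sub_one.2 (exists_sub_eq_pow_sub hZ i hx))
    rw [← hyx]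
    exact mem_map_sub_one.2 (exists_sub_eq_pow_sub hZ n hy)
  · have : x ∈ Z.map (∑ i ∈ range m, t ^ i) := by
      refine key _ _ fun p hp hpm => ?_
      have hp' := (h p hp hpm).2 hj
      have hfix : ∀ n : ℕ, (t ^ n) x = x := fun n => by
        induction n with
        | zero => simp
        | succ n ih => rw [pow_succ, Module.End.mul_apply, h0, ih]
      obtain ⟨y, hy, hyx⟩ := hp' x hx (hfix _)
      refine ⟨y, hy, ?_⟩
      rw [← congrArg (fun k => ∑ i ∈ range k, t ^ i) (hmul p)]
      have hc : Commute (∑ i ∈ range (m / p ^ m.factorization p), t ^ i)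
          (∑ i ∈ range (p ^ m.factorization p), (t ^ (m / p ^ m.factorization p)) ^ i) := by
        refine Commute.sum_left _ _ _ fun i _ => Commute.sum_right _ _ _ fun k _ => ?_
        rw [← pow_mul]; exact Commute.pow_pow_self t _ _
      rw [sum_pow_mul, ← hc.eq, Module.End.mul_apply, hyx, LinearMap.sum_apply]
      simp [hfix]
    obtain ⟨y, hy, hyx⟩ := this
    exact ⟨y, hy, hyx⟩

end Elementary

/-! ### Modules with a basis permuted up to sign. -/

section Monomial

variable {V I : Type*} [AddCommGroup V] {t : Module.End ℤ V} {m : ℕ}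
  (c : Module.Basis I ℤ V) (τ : Equiv.Perm I)

/-- A chosen representative of the `τ`-orbit of `i`. -/
noncomputable def orbitRep (i : I) : I :=
  Quotient.out (Quotient.mk (Equiv.Perm.SameCycle.setoid τ) i)

theorem sameCycle_orbitRep (i : I) : τ.SameCycle (orbitRep τ i) i :=
  Quotient.mk_out (s := Equiv.Perm.SameCycle.setoid τ) i

variable {τ} in
theorem orbitRep_eq_of_sameCycle {i k : I} (h : τ.SameCycle i k) :
    orbitRep τ i = orbitRep τ k :=
  congrArg Quotient.out (Quotient.sound (s := Equiv.Perm.SameCycle.setoid τ) h)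

theorem exists_pow_eq_of_sameCycle {i k : I} (h : τ.SameCycle i k) (hm : m ≠ 0)
    (hτm : (τ ^ m) k = k) : ∃ n < m, (τ ^ n) i = k := by
  obtain ⟨z, hz⟩ := h
  have hm' : (m : ℤ) ≠ 0 := by exact_mod_cast hm
  refine ⟨(z % m).toNat, ?_, ?_⟩
  · have := Int.emod_lt_of_pos z (by omega : (0 : ℤ) < m)
    have := Int.emod_nonneg z hm'
    omega
  · have h2 : ((τ ^ m) ^ (-(z / m)) : Equiv.Perm I) k = k :=
      Equiv.Perm.zpow_apply_eq_self_of_apply_eq_self hτm _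
    rw [← zpow_natCast, Int.toNat_of_nonneg (Int.emod_nonneg z hm'), Int.emod_def,
      sub_eq_neg_add, zpow_add, Equiv.Perm.mul_apply, hz, ← mul_neg, zpow_mul, zpow_natCast, h2]

variable {c τ}

theorem pow_apply_basis {u : I → ℤˣ} (ht : ∀ i, t (c i) = u i • c (τ i)) (n : ℕ) (i : I) :
    ∃ v : ℤˣ, (t ^ n) (c i) = v • c ((τ ^ n) i) := by
  induction n with
  | zero => exact ⟨1, by simp⟩
  | succ n ih =>
    obtain ⟨v, hv⟩ := ih
    refine ⟨v * u ((τ ^ n) i), ?_⟩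
    rw [pow_succ', Module.End.mul_apply, hv, Units.smul_def, map_zsmul, ht, pow_succ',
      Equiv.Perm.mul_apply, mul_smul, Units.smul_def v]

theorem mem_of_mem_span_basis {J : Set I} {p : Submodule ℤ V} (h : ∀ i ∈ J, c i ∈ p) {x : V}
    (hx : x ∈ Submodule.span ℤ (c '' J)) : x ∈ p := by
  refine Submodule.span_le.2 ?_ hx
  rintro _ ⟨i, hi, rfl⟩
  exact h i hi

theorem stable_span_basis {u : I → ℤˣ} (ht : ∀ i, t (c i) = u i • c (τ i)) {J : Set I}
    (hJ : ∀ i ∈ J, τ i ∈ J) (x : V) (hx : x ∈ Submodule.span ℤ (c '' J)) :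
    t x ∈ Submodule.span ℤ (c '' J) := by
  refine mem_of_mem_span_basis (p := (Submodule.span ℤ (c '' J)).comap t) (fun i hi => ?_) hx
  change t (c i) ∈ Submodule.span ℤ (c '' J)
  rw [ht, Units.smul_def]
  exact Submodule.smul_mem _ _ (Submodule.subset_span ⟨_, hJ i hi, rfl⟩)

/-- If `t` permutes a set of basis vectors freely up to signs, then averaging the projection to the
span of orbit representatives gives the identity. -/
theorem exists_sum_conj_eq {u : I → ℤˣ} (ht : ∀ i, t (c i) = u i • c (τ i)) {J : Set I}
    (hm : m ≠ 0) (htm : t ^ m = 1) (hτm : τ ^ m = 1)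
    (hfree : ∀ i ∈ J, ∀ n, (τ ^ n) i = i → m ∣ n) :
    ∃ θ : Module.End ℤ V, (∀ x ∈ Submodule.span ℤ (c '' J), θ x ∈ Submodule.span ℤ (c '' J)) ∧
      ∀ x ∈ Submodule.span ℤ (c '' J), ∑ n ∈ range m, (t ^ n) (θ ((t ^ (m - n)) x)) = x := by
  classical
  let θ : Module.End ℤ V := c.constr ℤ fun i => if orbitRep τ i = i then c i else 0
  have hθ : ∀ i, θ (c i) = if orbitRep τ i = i then c i else 0 := fun i => c.constr_basis _ _ _
  refine ⟨θ, fun x hx => ?_, fun x hx => ?_⟩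
  · refine Submodule.span_le (p := (Submodule.span ℤ (c '' J)).comap θ).2 ?_ hx
    rintro _ ⟨i, hi, rfl⟩
    change θ (c i) ∈ Submodule.span ℤ (c '' J)
    rw [hθ]
    split_ifs
    · exact Submodule.subset_span ⟨_, hi, rfl⟩
    · exact Submodule.zero_mem _
  · suffices Submodule.span ℤ (c '' J) ≤
      LinearMap.eqLocus (∑ n ∈ range m, t ^ n * θ * t ^ (m - n)) 1 by
      have := this hx
      simpa [LinearMap.mem_eqLocus, LinearMap.sum_apply] using this
    rw [Submodule.span_le]
    rintro _ ⟨i, hi, rfl⟩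
    simp only [SetLike.mem_coe, LinearMap.mem_eqLocus, LinearMap.sum_apply, Module.End.mul_apply,
      Module.End.one_apply]
    have hterm : ∀ n ∈ range m, (t ^ n) (θ ((t ^ (m - n)) (c i))) =
        if (τ ^ (m - n)) i = orbitRep τ i then c i else 0 := by
      intro n hn
      obtain ⟨v, hv⟩ := pow_apply_basis ht (m - n) i
      have hs : orbitRep τ ((τ ^ (m - n)) i) = orbitRep τ i :=
        orbitRep_eq_of_sameCycle (Equiv.Perm.SameCycle.symm ⟨(m - n : ℕ), by simp⟩)
      rw [hv, Units.smul_def, map_zsmul, hθ, hs]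
      by_cases h : (τ ^ (m - n)) i = orbitRep τ i
      · rw [if_pos h.symm, if_pos h, ← Units.smul_def, ← hv, ← Module.End.mul_apply, ← pow_add,
          Nat.add_sub_cancel' (mem_range.1 hn).le, htm, Module.End.one_apply]
      · rw [if_neg (Ne.symm h), if_neg h, smul_zero, map_zero]
    rw [sum_congr rfl hterm, ← sum_filter]
    obtain ⟨n, hn, hni⟩ := exists_pow_eq_of_sameCycle τ (sameCycle_orbitRep τ i) hm (by simp [hτm])
    have hfil : (range m).filter (fun n => (τ ^ (m - n)) i = orbitRep τ i) = {n} := by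
      ext k
      simp only [mem_filter, mem_range, mem_singleton]
      refine ⟨fun ⟨hk, hki⟩ => ?_, ?_⟩
      -- The exponent lies strictly between `0` and `2 * m`, so divisibility by `m` forces it to
      -- equal `m`, giving `k = n`.
      · have hfix : (τ ^ (n + (m - k))) i = i := by
          rw [pow_add, Equiv.Perm.mul_apply, hki, hni]
        obtain ⟨a, ha⟩ := hfree i hi _ hfix
        have : a = 1 := by
          have h1 : a ≠ 0 := by rintro rfl; omega
          have h2 : a < 2 := by
            by_contra h2
            have := Nat.mul_le_mul_left m (not_lt.1 h2)
            omega
          omega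
        subst this
        omega
      · rintro rfl
        refine ⟨hn, ?_⟩
        conv_lhs => rw [← hni]
        rw [← Equiv.Perm.mul_apply, ← pow_add, Nat.sub_add_cancel hn.le, hτm,
          Equiv.Perm.one_apply]
    rw [hfil, sum_singleton]

/-- The identity is the norm of `θ` under conjugation; on a fixed `x` it reads `x = N (θ x)`. Signs
do no harm because the orbits are free. -/
theorem TateZeroVanishes.of_free_monomial {u : I → ℤˣ} (ht : ∀ i, t (c i) = u i • c (τ i))
    {J : Set I} (hm : m ≠ 0) (htm : t ^ m = 1) (hτm : τ ^ m = 1)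
    (hfree : ∀ i ∈ J, ∀ n, (τ ^ n) i = i → m ∣ n) :
    TateZeroVanishes t m (Submodule.span ℤ (c '' J)) := by
  obtain ⟨θ, hθ, hsum⟩ := exists_sum_conj_eq ht hm htm hτm hfree
  intro x hx h0
  have hfix : ∀ n : ℕ, (t ^ n) x = x := fun n => by
    induction n with
    | zero => simp
    | succ n ih => rw [pow_succ, Module.End.mul_apply, h0, ih]
  refine ⟨θ x, hθ x hx, ?_⟩
  rw [LinearMap.sum_apply]
  conv_rhs => rw [← hsum x hx]
  exact sum_congr rfl fun n _ => by rw [hfix]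

theorem TateNegVanishes.of_free_monomial {u : I → ℤˣ} (ht : ∀ i, t (c i) = u i • c (τ i))
    {J : Set I} (hJ : ∀ i ∈ J, τ i ∈ J) (hm : m ≠ 0) (htm : t ^ m = 1) (hτm : τ ^ m = 1)
    (hfree : ∀ i ∈ J, ∀ n, (τ ^ n) i = i → m ∣ n) :
    TateNegVanishes t m (Submodule.span ℤ (c '' J)) := by
  obtain ⟨θ, hθ, hsum⟩ := exists_sum_conj_eq ht hm htm hτm hfree
  intro x hx h0
  have hst := stable_span_basis ht hJ
  -- This sum is `θ (t (N x))`. Subtracting it from the averaging formula for `x` leaves terms `t ^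
  -- n y - y`, all in the image of `t - 1`.
  have hz : ∑ n ∈ range m, θ ((t ^ (m - n)) x) = 0 := by
    rw [← map_sum, ← sum_range_reflect]
    have : ∀ n ∈ range m, (t ^ (m - (m - 1 - n))) x = t ((t ^ n) x) := fun n hn => by
      rw [← Module.End.mul_apply, ← pow_succ']
      congr 2
      have := mem_range.1 hn
      omega
    rw [sum_congr rfl this, ← map_sum, ← LinearMap.sum_apply, h0, map_zero, map_zero]
  rw [← mem_map_sub_one, ← hsum x hx, ← sub_zero (∑ n ∈ range m, _), ← hz, ← sum_sub_distrib]
  exact Submodule.sum_mem _ fun n _ => mem_map_sub_one.2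
    (exists_sub_eq_pow_sub hst n (hθ _ (pow_mem_of_stable hst _ hx)))

/-- Let `r` collapse each orbit to its representative. Then `r x` and `x` agree modulo the image of
`t - 1`, while `r ∘ t = r` gives `m • r x = r (N x) = 0`, so `r x = 0` because the module is
torsion-free. Orbits need not be free, but signs are not allowed. -/
theorem TateNegVanishes.of_permutation {J : Set I} (ht : ∀ i ∈ J, t (c i) = c (τ i))
    (hJ : ∀ i ∈ J, τ i ∈ J) (hm : m ≠ 0) (hτm : τ ^ m = 1) :
    TateNegVanishes t m (Submodule.span ℤ (c '' J)) := by
  intro x hx h0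
  have hst : ∀ x ∈ Submodule.span ℤ (c '' J), t x ∈ Submodule.span ℤ (c '' J) := by
    intro x hx
    refine mem_of_mem_span_basis (p := (Submodule.span ℤ (c '' J)).comap t) (fun i hi => ?_) hx
    change t (c i) ∈ Submodule.span ℤ (c '' J)
    rw [ht i hi]
    exact Submodule.subset_span ⟨_, hJ i hi, rfl⟩
  let r : Module.End ℤ V := c.constr ℤ fun i => c (orbitRep τ i)
  have hr : ∀ i, r (c i) = c (orbitRep τ i) := fun i => c.constr_basis _ _ _
  have hrt : ∀ y ∈ Submodule.span ℤ (c '' J), r (t y) = r y := by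
    intro y hy
    refine mem_of_mem_span_basis (p := LinearMap.eqLocus (r * t) r) (fun i hi => ?_) hy
    change r (t (c i)) = r (c i)
    rw [ht i hi, hr, hr]
    exact congrArg c (orbitRep_eq_of_sameCycle (Equiv.Perm.SameCycle.symm ⟨1, by simp⟩))
  have hpow : ∀ i ∈ J, ∀ n, (τ ^ n) i ∈ J ∧ (t ^ n) (c i) = c ((τ ^ n) i) := by
    intro i hi n
    induction n with
    | zero => simpa
    | succ n ih =>
      rw [pow_succ', pow_succ', Module.End.mul_apply, ih.2, ht _ ih.1, Equiv.Perm.mul_apply]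
      exact ⟨hJ _ ih.1, rfl⟩
  have hxr : ∀ y ∈ Submodule.span ℤ (c '' J),
      r y - y ∈ (Submodule.span ℤ (c '' J)).map (t - 1) := by
    intro y hy
    refine mem_of_mem_span_basis (p := ((Submodule.span ℤ (c '' J)).map (t - 1)).comap (r - 1))
      (fun i hi => ?_) hy
    change r (c i) - c i ∈ (Submodule.span ℤ (c '' J)).map (t - 1)
    obtain ⟨n, -, hn⟩ := exists_pow_eq_of_sameCycle τ (sameCycle_orbitRep τ i).symm hm
      (k := orbitRep τ i) (by simp [hτm])
    rw [hr, ← hn, ← (hpow i hi n).2]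
    exact mem_map_sub_one.2 (exists_sub_eq_pow_sub hst n (Submodule.subset_span ⟨i, hi, rfl⟩))
  have hr0 : r x = 0 := by
    have h1 : ∀ n, r ((t ^ n) x) = r x := fun n => by
      induction n with
      | zero => simp
      | succ n ih => rw [pow_succ', Module.End.mul_apply, hrt _ (pow_mem_of_stable hst n hx), ih]
    have h2 := congrArg r h0
    rw [LinearMap.sum_apply, map_sum, sum_congr rfl fun n _ => h1 n, map_zero, sum_const,
      card_range] at h2
    have : Module.Free ℤ V := Module.Free.of_basis c
    rw [← natCast_zsmul] at h2
    exact (smul_eq_zero.1 h2).resolve_left (by exact_mod_cast hm)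
  rw [← mem_map_sub_one]
  simpa [hr0] using Submodule.neg_mem _ (hxr x hx)

end Monomial

/-! ### Wedge, contraction and functoriality on the monomial basis of an exterior algebra, up to
sign. -/

section ExteriorBasis

open ExteriorAlgebra CliffordAlgebra

variable {S A : Type*} [AddCommGroup A] (b : Module.Basis S ℤ A)

/-- The wedge product of a list of basis vectors. -/
noncomputable def wedgeList (l : List S) : ExteriorAlgebra ℤ A :=
  (l.map fun s => ExteriorAlgebra.ι ℤ (b s)).prod

theorem wedgeList_cons (s : S) (l : List S) :
    wedgeList b (s :: l) = ExteriorAlgebra.ι ℤ (b s) * wedgeList b l := by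
  simp [wedgeList]

theorem wedgeList_perm {l l' : List S} (h : l.Perm l') :
    ∃ u : ℤˣ, wedgeList b l = u • wedgeList b l' := by
  induction h with
  | nil => exact ⟨1, by simp⟩
  | cons x _ ih =>
    obtain ⟨u, hu⟩ := ih
    exact ⟨u, by rw [wedgeList_cons, wedgeList_cons, hu, Units.smul_def, mul_smul_comm,
      ← Units.smul_def]⟩
  | swap x y l =>
    refine ⟨-1, ?_⟩
    simp only [wedgeList_cons, ← mul_assoc, Units.smul_def, Units.val_neg, Units.val_one, neg_smul,
      one_smul, ← neg_mul]
    rw [eq_neg_of_add_eq_zero_left (ι_add_mul_swap (R := ℤ) (b y) (b x)), neg_mul, neg_mul, neg_mul]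
  | trans _ _ ih₁ ih₂ =>
    obtain ⟨u, hu⟩ := ih₁
    obtain ⟨v, hv⟩ := ih₂
    exact ⟨u * v, by rw [hu, hv, mul_smul]⟩

variable [LinearOrder S]

theorem exists_list_basis_eq (T : Finset S) :
    ∃ l : List S, l.Nodup ∧ l.toFinset = T ∧ b.ExteriorAlgebra T = wedgeList b l := by
  let f := Set.powersetCard.ofFinEmbEquiv.symm (Set.powersetCard.prodEquiv.symm T).2
  refine ⟨List.ofFn f, List.nodup_ofFn.2 f.injective, ?_, ?_⟩
  · ext s
    simp only [List.mem_toFinset, List.mem_ofFn]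
    exact Set.powersetCard.mem_range_ofFinEmbEquiv_symm_iff_mem _ _
  · rw [ExteriorAlgebra.basis_apply, wedgeList, List.map_ofFn]
    rfl

theorem wedgeList_eq_smul_basis {l : List S} (hl : l.Nodup) :
    ∃ u : ℤˣ, wedgeList b l = u • b.ExteriorAlgebra l.toFinset := by
  obtain ⟨l', hl', hll', h⟩ := exists_list_basis_eq b l.toFinset
  rw [h]
  exact wedgeList_perm b (List.perm_of_nodup_nodup_toFinset_eq hl hl' hll'.symm)

theorem ι_mul_basis_of_notMem {s : S} {T : Finset S} (hs : s ∉ T) :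
    ∃ u : ℤˣ, ExteriorAlgebra.ι ℤ (b s) * b.ExteriorAlgebra T =
      u • b.ExteriorAlgebra (insert s T) := by
  obtain ⟨l, hl, rfl, h⟩ := exists_list_basis_eq b T
  rw [h, ← wedgeList_cons]
  simpa using wedgeList_eq_smul_basis b (List.nodup_cons.2 ⟨by simpa using hs, hl⟩)

theorem basis_eq_smul_ι_mul {s : S} {T : Finset S} (hs : s ∈ T) :
    ∃ u : ℤˣ, b.ExteriorAlgebra T =
      u • (ExteriorAlgebra.ι ℤ (b s) * b.ExteriorAlgebra (T.erase s)) := by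
  obtain ⟨u, hu⟩ := ι_mul_basis_of_notMem b (T.notMem_erase s)
  rw [insert_erase hs] at hu
  exact ⟨u⁻¹, by rw [hu, inv_smul_smul]⟩

theorem ι_mul_basis_of_mem {s : S} {T : Finset S} (hs : s ∈ T) :
    ExteriorAlgebra.ι ℤ (b s) * b.ExteriorAlgebra T = 0 := by
  obtain ⟨u, hu⟩ := basis_eq_smul_ι_mul b hs
  rw [hu, Units.smul_def, mul_smul_comm, ← mul_assoc, ι_sq_zero, zero_mul, smul_zero]

theorem contractLeft_coord_basis_of_notMem {s : S} {T : Finset S} (hs : s ∉ T) :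
    contractLeft (b.coord s) (b.ExteriorAlgebra T) = 0 := by
  obtain ⟨l, -, rfl, h⟩ := exists_list_basis_eq b T
  rw [h]
  clear h
  induction l with
  | nil => simp [wedgeList, contractLeft_one]
  | cons a l ih =>
    have hsl : s ≠ a ∧ s ∉ l.toFinset := by simpa [not_or] using hs
    rw [wedgeList_cons, contractLeft_ι_mul, ih hsl.2]
    simp [hsl.1.symm]

theorem contractLeft_coord_basis_of_mem {s : S} {T : Finset S} (hs : s ∈ T) :
    ∃ u : ℤˣ, contractLeft (b.coord s) (b.ExteriorAlgebra T) =
      u • b.ExteriorAlgebra (T.erase s) := by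
  obtain ⟨u, hu⟩ := basis_eq_smul_ι_mul b hs
  refine ⟨u, ?_⟩
  rw [hu, Units.smul_def, map_zsmul, contractLeft_ι_mul,
    contractLeft_coord_basis_of_notMem b (T.notMem_erase s)]
  simp [Units.smul_def]

theorem map_basis {f : A →ₗ[ℤ] A} {τ : Equiv.Perm S} (hf : ∀ s, f (b s) = b (τ s))
    (T : Finset S) : ∃ u : ℤˣ, ExteriorAlgebra.map f (b.ExteriorAlgebra T) =
      u • b.ExteriorAlgebra (T.map τ.toEmbedding) := by
  obtain ⟨l, hl, rfl, h⟩ := exists_list_basis_eq b T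
  have h1 : ExteriorAlgebra.map f (wedgeList b l) = wedgeList b (l.map τ) := by
    simp only [wedgeList, map_list_prod, List.map_map]
    congr 2
    ext s
    simp [hf]
  rw [h, h1]
  have := wedgeList_eq_smul_basis b (hl.map τ.injective)
  convert this using 5
  ext s
  simp only [Finset.mem_map_equiv, List.mem_toFinset, List.mem_map]
  exact ⟨fun h => ⟨_, h, τ.apply_symm_apply s⟩, by rintro ⟨a, ha, rfl⟩; simpa⟩

/-- The submodule spanned by the wedge products indexed by `Q`. -/
noncomputable def wedgeSpan (Q : Set (Finset S)) : Submodule ℤ (ExteriorAlgebra ℤ A) :=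
  Submodule.span ℤ (b.ExteriorAlgebra '' Q)

open Classical in
/-- The coordinate projection to `wedgeSpan b Q`. -/
noncomputable def wedgeProj (Q : Set (Finset S)) : Module.End ℤ (ExteriorAlgebra ℤ A) :=
  b.ExteriorAlgebra.constr ℤ fun T => if T ∈ Q then b.ExteriorAlgebra T else 0

variable {b} {Q Q' : Set (Finset S)} {w : ExteriorAlgebra ℤ A}

theorem wedgeProj_of_mem {T : Finset S} (h : T ∈ Q) :
    wedgeProj b Q (b.ExteriorAlgebra T) = b.ExteriorAlgebra T := by
  classical
  rw [wedgeProj, Module.Basis.constr_basis, if_pos h]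

theorem wedgeProj_of_notMem {T : Finset S} (h : T ∉ Q) :
    wedgeProj b Q (b.ExteriorAlgebra T) = 0 := by
  classical
  rw [wedgeProj, Module.Basis.constr_basis, if_neg h]

theorem basis_mem_wedgeSpan {T : Finset S} (h : T ∈ Q) : b.ExteriorAlgebra T ∈ wedgeSpan b Q :=
  Submodule.subset_span ⟨T, h, rfl⟩

theorem wedgeSpan_mono (h : Q ⊆ Q') : wedgeSpan b Q ≤ wedgeSpan b Q' :=
  Submodule.span_mono (Set.image_mono h)

theorem map_mem_wedgeSpan {f : Module.End ℤ (ExteriorAlgebra ℤ A)}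
    (h : ∀ T ∈ Q, f (b.ExteriorAlgebra T) ∈ wedgeSpan b Q') (hw : w ∈ wedgeSpan b Q) :
    f w ∈ wedgeSpan b Q' :=
  mem_of_mem_span_basis (p := (wedgeSpan b Q').comap f) h hw

theorem eq_of_eq_on_wedgeSpan {M : Type*} [AddCommGroup M] {f g : ExteriorAlgebra ℤ A →ₗ[ℤ] M}
    (h : ∀ T ∈ Q, f (b.ExteriorAlgebra T) = g (b.ExteriorAlgebra T)) (hw : w ∈ wedgeSpan b Q) :
    f w = g w :=
  mem_of_mem_span_basis (p := LinearMap.eqLocus f g) h hw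

theorem wedgeSpan_univ : wedgeSpan b Set.univ = ⊤ := by
  rw [wedgeSpan, Set.image_univ, Module.Basis.span_eq]

theorem wedgeProj_mem_inter (h : w ∈ wedgeSpan b Q) (Q' : Set (Finset S)) :
    wedgeProj b Q' w ∈ wedgeSpan b (Q ∩ Q') := by
  refine map_mem_wedgeSpan (fun T hT => ?_) h
  by_cases hT' : T ∈ Q'
  · rw [wedgeProj_of_mem hT']
    exact basis_mem_wedgeSpan ⟨hT, hT'⟩
  · rw [wedgeProj_of_notMem hT']
    exact Submodule.zero_mem _

theorem wedgeProj_mem (Q : Set (Finset S)) (w : ExteriorAlgebra ℤ A) :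
    wedgeProj b Q w ∈ wedgeSpan b Q := by
  have := wedgeProj_mem_inter (b := b) (Q := Set.univ) (w := w) (by simp [wedgeSpan_univ]) Q
  rwa [Set.univ_inter] at this

theorem wedgeProj_eq_self (hw : w ∈ wedgeSpan b Q) (h : Q ⊆ Q') : wedgeProj b Q' w = w :=
  eq_of_eq_on_wedgeSpan (f := wedgeProj b Q') (g := LinearMap.id)
    (fun T hT => by rw [wedgeProj_of_mem (h hT)]; rfl) hw

theorem wedgeProj_eq_zero (hw : w ∈ wedgeSpan b Q) (h : ∀ T ∈ Q, T ∉ Q') :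
    wedgeProj b Q' w = 0 :=
  eq_of_eq_on_wedgeSpan (f := wedgeProj b Q') (g := 0)
    (fun T hT => by rw [wedgeProj_of_notMem (h T hT)]; rfl) hw

theorem linearMap_ext_wedge {M : Type*} [AddCommGroup M] {f g : ExteriorAlgebra ℤ A →ₗ[ℤ] M}
    (h : ∀ T, f (b.ExteriorAlgebra T) = g (b.ExteriorAlgebra T)) (w) : f w = g w :=
  eq_of_eq_on_wedgeSpan (b := b) (Q := Set.univ) (fun T _ => h T) (by simp [wedgeSpan_univ])

theorem wedgeProj_add_compl (Q : Set (Finset S)) (w : ExteriorAlgebra ℤ A) :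
    wedgeProj b Q w + wedgeProj b Qᶜ w = w := by
  refine linearMap_ext_wedge (f := wedgeProj b Q + wedgeProj b Qᶜ) (g := LinearMap.id)
    (b := b) (fun T => ?_) w
  by_cases hT : T ∈ Q
  · simp [wedgeProj_of_mem hT, wedgeProj_of_notMem (Q := Qᶜ) (T := T) (by simpa using hT)]
  · simp [wedgeProj_of_notMem hT, wedgeProj_of_mem (Q := Qᶜ) (T := T) hT]

theorem contractLeft_coord_mem {s : S} (h : ∀ T ∈ Q, s ∈ T → T.erase s ∈ Q')
    (hw : w ∈ wedgeSpan b Q) : contractLeft (b.coord s) w ∈ wedgeSpan b Q' := by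
  refine map_mem_wedgeSpan (f := contractLeft (b.coord s)) (fun T hT => ?_) hw
  by_cases hs : s ∈ T
  · obtain ⟨u, hu⟩ := contractLeft_coord_basis_of_mem b hs
    rw [hu, Units.smul_def]
    exact Submodule.smul_mem _ _ (basis_mem_wedgeSpan (h T hT hs))
  · rw [contractLeft_coord_basis_of_notMem b hs]
    exact Submodule.zero_mem _

theorem ι_mul_mem {s : S} (h : ∀ T ∈ Q, s ∉ T → insert s T ∈ Q')
    (hw : w ∈ wedgeSpan b Q) : ExteriorAlgebra.ι ℤ (b s) * w ∈ wedgeSpan b Q' := by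
  refine map_mem_wedgeSpan (f := LinearMap.mulLeft ℤ (ExteriorAlgebra.ι ℤ (b s)))
    (fun T hT => ?_) hw
  rw [LinearMap.mulLeft_apply]
  by_cases hs : s ∈ T
  · rw [ι_mul_basis_of_mem b hs]
    exact Submodule.zero_mem _
  · obtain ⟨u, hu⟩ := ι_mul_basis_of_notMem b hs
    rw [hu, Units.smul_def]
    exact Submodule.smul_mem _ _ (basis_mem_wedgeSpan (h T hT hs))

theorem wedgeProj_contractLeft_coord {s : S} (h : ∀ T, s ∈ T → (T.erase s ∈ Q ↔ T ∈ Q'))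
    (w : ExteriorAlgebra ℤ A) :
    wedgeProj b Q (contractLeft (b.coord s) w) = contractLeft (b.coord s) (wedgeProj b Q' w) := by
  refine linearMap_ext_wedge (b := b) (f := wedgeProj b Q ∘ₗ contractLeft (b.coord s))
    (g := contractLeft (b.coord s) ∘ₗ wedgeProj b Q') (fun T => ?_) w
  simp only [LinearMap.comp_apply]
  by_cases hs : s ∈ T
  · obtain ⟨u, hu⟩ := contractLeft_coord_basis_of_mem b hs
    by_cases hT : T ∈ Q'
    · rw [wedgeProj_of_mem hT, hu, Units.smul_def, map_zsmul, wedgeProj_of_mem ((h T hs).2 hT)]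
    · rw [wedgeProj_of_notMem hT, hu, Units.smul_def, map_zsmul,
        wedgeProj_of_notMem (mt (h T hs).1 hT), smul_zero, map_zero]
  · rw [contractLeft_coord_basis_of_notMem b hs, map_zero]
    by_cases hT : T ∈ Q'
    · rw [wedgeProj_of_mem hT, contractLeft_coord_basis_of_notMem b hs]
    · rw [wedgeProj_of_notMem hT, map_zero]

theorem wedgeProj_map {f : A →ₗ[ℤ] A} {τ : Equiv.Perm S} (hf : ∀ s, f (b s) = b (τ s))
    (h : ∀ T, T.map τ.toEmbedding ∈ Q ↔ T ∈ Q') (w : ExteriorAlgebra ℤ A) :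
    wedgeProj b Q (ExteriorAlgebra.map f w) = ExteriorAlgebra.map f (wedgeProj b Q' w) := by
  refine linearMap_ext_wedge (b := b) (f := wedgeProj b Q ∘ₗ (ExteriorAlgebra.map f).toLinearMap)
    (g := (ExteriorAlgebra.map f).toLinearMap ∘ₗ wedgeProj b Q') (fun T => ?_) w
  simp only [LinearMap.comp_apply, AlgHom.toLinearMap_apply]
  obtain ⟨u, hu⟩ := map_basis b hf T
  by_cases hT : T ∈ Q'
  · rw [wedgeProj_of_mem hT, hu, Units.smul_def, map_zsmul, wedgeProj_of_mem ((h T).2 hT)]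
  · rw [wedgeProj_of_notMem hT, hu, Units.smul_def, map_zsmul,
      wedgeProj_of_notMem (mt (h T).1 hT), smul_zero, map_zero]

theorem contractLeft_map {M N : Type*} [AddCommGroup M] [AddCommGroup N] (f : M →ₗ[ℤ] N)
    (φ : Module.Dual ℤ N) (x : ExteriorAlgebra ℤ M) :
    contractLeft φ (ExteriorAlgebra.map f x) =
      ExteriorAlgebra.map f (contractLeft (φ ∘ₗ f) x) := by
  induction x using CliffordAlgebra.left_induction with
  | algebraMap r => rw [AlgHom.commutes, contractLeft_algebraMap, contractLeft_algebraMap, map_zero]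
  | add x y hx hy => simp only [map_add, hx, hy]
  | ι_mul x v hx =>
    rw [map_mul]
    erw [ExteriorAlgebra.map_apply_ι]
    rw [contractLeft_ι_mul, contractLeft_ι_mul, hx, map_sub, map_mul]
    erw [ExteriorAlgebra.map_apply_ι]
    simp

end ExteriorBasis

/-! ### Exactness of the bounded Koszul complex. -/

section Exactness

open ExteriorAlgebra CliffordAlgebra

variable {S X A : Type*} [DecidableEq X] (π : S → X)

/-- The number of elements of `T` in the fibre of `π` over `x`. -/
def fibreCard (T : Finset S) (x : X) : ℕ := #{s ∈ T | π s = x}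

theorem sum_fibreCard [Fintype X] (T : Finset S) : ∑ x, fibreCard π T x = #T :=
  (card_eq_sum_card_fiberwise (fun _ _ => mem_univ _)).symm

variable {π}

section Functionals

variable [AddCommGroup A] [Fintype S] (b : Module.Basis S ℤ A)

variable (π) in
/-- The functional summing the coordinates in the fibre over `x`. -/
noncomputable def fibreSum (x : X) : Module.Dual ℤ A := ∑ s with π s = x, b.coord s

/-- The functional summing all coordinates. -/
noncomputable def coordSum : Module.Dual ℤ A := ∑ s, b.coord s

theorem fibreSum_basis (x : X) (s : S) : fibreSum π b x (b s) = if π s = x then 1 else 0 := by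
  classical
  simp only [fibreSum, LinearMap.sum_apply, Module.Basis.coord_apply, Module.Basis.repr_self,
    Finsupp.single_apply, sum_ite_eq, mem_filter, mem_univ, true_and]

theorem coordSum_basis (s : S) : coordSum b (b s) = 1 := by
  classical
  simp [coordSum, LinearMap.sum_apply, Finsupp.single_apply]

theorem contractLeft_fibreSum (x : X) (w : ExteriorAlgebra ℤ A) :
    contractLeft (fibreSum π b x) w = ∑ s with π s = x, contractLeft (b.coord s) w := by
  simp [fibreSum, map_sum, LinearMap.sum_apply]

theorem contractLeft_coordSum (w : ExteriorAlgebra ℤ A) :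
    contractLeft (coordSum b) w = ∑ s, contractLeft (b.coord s) w := by
  simp [coordSum, map_sum, LinearMap.sum_apply]

end Functionals

variable [LinearOrder S]

theorem fibreCard_erase_of_ne {s : S} {x : X} (h : π s ≠ x) (T : Finset S) :
    fibreCard π (T.erase s) x = fibreCard π T x := by
  rw [fibreCard, fibreCard, filter_erase, erase_eq_of_notMem (by simp [h])]

theorem fibreCard_erase_add_one {s : S} {T : Finset S} (hs : s ∈ T) :
    fibreCard π (T.erase s) (π s) + 1 = fibreCard π T (π s) := by
  rw [fibreCard, fibreCard, filter_erase, card_erase_add_one (by simp [hs])]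

theorem fibreCard_insert_of_ne {s : S} {x : X} (h : π s ≠ x) (T : Finset S) :
    fibreCard π (insert s T) x = fibreCard π T x := by
  rw [fibreCard, fibreCard, filter_insert, if_neg h]

theorem fibreCard_insert {s : S} {T : Finset S} (hs : s ∉ T) :
    fibreCard π (insert s T) (π s) = fibreCard π T (π s) + 1 := by
  rw [fibreCard, fibreCard, filter_insert, if_pos rfl, card_insert_of_notMem (by simp [hs])]

variable [AddCommGroup A] [Fintype S] {b : Module.Basis S ℤ A}

theorem contractLeft_coordSum_mem {Q Q' : Set (Finset S)} {w : ExteriorAlgebra ℤ A}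
    (h : ∀ T ∈ Q, ∀ s ∈ T, T.erase s ∈ Q') (hw : w ∈ wedgeSpan b Q) :
    contractLeft (coordSum b) w ∈ wedgeSpan b Q' := by
  rw [contractLeft_coordSum]
  exact Submodule.sum_mem _ fun s _ => contractLeft_coord_mem (fun T hT hsT => h T hT s hsT) hw

variable (π) in
/-- The index sets of size `n` whose fibres have size at most `a`. -/
def boundedSets (a : X → ℕ) (n : ℕ) : Set (Finset S) := {T | #T = n ∧ ∀ x, fibreCard π T x ≤ a x}

/-- Compare the parts of `d w = 0` with exactly `a x` elements over `x`. Contraction by a coordinate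
over `x` could reach this degree only from `a x + 1`, which does not occur in `w`. Hence the
coordinates off the fibre already contract the maximal part of `w` to zero. -/
theorem contractLeft_coordSum_fibreCard_eq {a : X → ℕ} {x : X} {w : ExteriorAlgebra ℤ A}
    {Q : Set (Finset S)} (hQ : ∀ T ∈ Q, fibreCard π T x ≤ a x)
    (hw : w ∈ wedgeSpan b Q) (hdw : contractLeft (coordSum b) w = 0) :
    contractLeft (coordSum b) (wedgeProj b {T | fibreCard π T x = a x} w) =
      contractLeft (fibreSum π b x) (wedgeProj b {T | fibreCard π T x = a x} w) := by
  set R : Set (Finset S) := {T | fibreCard π T x = a x} with hR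
  have hproj : wedgeProj b R (contractLeft (coordSum b) w) = 0 := by rw [hdw, map_zero]
  rw [contractLeft_coordSum, map_sum, ← sum_filter_add_sum_filter_not _ (fun s => π s = x)] at hproj
  have h1 : ∑ s with π s = x, wedgeProj b R (contractLeft (b.coord s) w) = 0 := by
    refine sum_eq_zero fun s hs => ?_
    have hs : π s = x := by simpa using hs
    rw [wedgeProj_contractLeft_coord (Q' := {T | fibreCard π T x = a x + 1}),
      wedgeProj_eq_zero hw, map_zero]
    · intro T hT hT'
      have := hQ T hT
      simp only [Set.mem_ofPred_eq] at hT'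
      omega
    · intro T hT
      have := fibreCard_erase_add_one (π := π) hT
      rw [hs] at this
      simp only [hR, Set.mem_ofPred_eq]
      omega
  have h2 : ∑ s with ¬ π s = x, contractLeft (b.coord s) (wedgeProj b R w) = 0 := by
    rw [h1, zero_add] at hproj
    rw [← hproj]
    refine sum_congr rfl fun s hs => ?_
    rw [wedgeProj_contractLeft_coord]
    intro T _
    simp only [hR, Set.mem_ofPred_eq]
    rw [fibreCard_erase_of_ne (by simpa using hs)]
  rw [contractLeft_coordSum, contractLeft_fibreSum,
    ← sum_filter_add_sum_filter_not _ (fun s => π s = x), h2, add_zero]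

/-- One step of the contraction of the bounded Koszul complex. -/
theorem exists_fibreCard_eq_step {a : X → ℕ} {n : ℕ} {Y : Set X} {x : X} (hx : x ∉ Y) {z : S}
    (hz : π z = x) {w : ExteriorAlgebra ℤ A}
    (hw : w ∈ wedgeSpan b (boundedSets π a n ∩ {T | ∀ y ∈ Y, fibreCard π T y = a y}))
    (hdw : contractLeft (coordSum b) w = 0) :
    ∃ v ∈ wedgeSpan b (boundedSets π a (n + 1)), w - contractLeft (coordSum b) v ∈
      wedgeSpan b (boundedSets π a n ∩ {T | ∀ y ∈ insert x Y, fibreCard π T y = a y}) := by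
  set R : Set (Finset S) := {T | fibreCard π T x = a x} with hR
  set Q := boundedSets π a n ∩ {T | ∀ y ∈ Y, fibreCard π T y = a y} with hQ
  have hle : ∀ T ∈ Q, ∀ y, fibreCard π T y ≤ a y := fun T hT => hT.1.2
  -- Wedging with `b z` is a contracting homotopy, since `coordSum` is `1` on `b z`. It respects the
  -- bound only on the part of `w` with fewer than `a x` elements over `x`, so it is applied to that
  -- part alone.
  refine ⟨ExteriorAlgebra.ι ℤ (b z) * wedgeProj b Rᶜ w, ?_, ?_⟩
  · refine ι_mul_mem (fun T hT hzT => ?_) (wedgeProj_mem_inter hw _)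
    refine ⟨by rw [card_insert_of_notMem hzT, hT.1.1.1], fun y => ?_⟩
    by_cases hy : x = y
    · subst hy
      have h1 := hle T hT.1 x
      have h2 : fibreCard π T x ≠ a x := hT.2
      rw [← hz, fibreCard_insert hzT, hz]
      omega
    · rw [fibreCard_insert_of_ne (by rwa [hz])]
      exact hle T hT.1 y
  · have hsplit : wedgeProj b Rᶜ w = w - wedgeProj b R w :=
      eq_sub_of_add_eq' (wedgeProj_add_compl R w)
    have h1 : w - contractLeft (coordSum b) (ExteriorAlgebra.ι ℤ (b z) * wedgeProj b Rᶜ w) =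
        wedgeProj b R w - ExteriorAlgebra.ι ℤ (b z) *
          contractLeft (fibreSum π b x) (wedgeProj b R w) := by
      rw [contractLeft_ι_mul, coordSum_basis, one_smul, hsplit, map_sub, hdw, zero_sub,
        contractLeft_coordSum_fibreCard_eq (fun T hT => hle T hT x) hw hdw, mul_neg]
      abel
    rw [h1]
    have hQR : Q ∩ R ⊆ boundedSets π a n ∩ {T | ∀ y ∈ insert x Y, fibreCard π T y = a y} := by
      rintro T ⟨⟨hT1, hT2⟩, hT3⟩
      refine ⟨hT1, fun y hy => ?_⟩
      rcases hy with rfl | hy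
      exacts [hT3, hT2 y hy]
    have hP := wedgeProj_mem_inter hw R
    refine Submodule.sub_mem _ (wedgeSpan_mono hQR hP) ?_
    rw [contractLeft_fibreSum, mul_sum]
    refine Submodule.sum_mem _ fun s hs => ?_
    have hs : π s = x := by simpa using hs
    -- Removing `s` and inserting `z` from the same fibre leaves every fibre count unchanged.
    refine ι_mul_mem (Q := {T | s ∉ T ∧ insert s T ∈ Q ∩ R}) (fun T hT hzT => ?_)
      (contractLeft_coord_mem (fun T hT hsT => ⟨T.notMem_erase s, by rwa [insert_erase hsT]⟩) hP)
    have hcard : ∀ y, fibreCard π (insert z T) y = fibreCard π (insert s T) y := by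
      intro y
      by_cases hy : x = y
      · subst hy
        conv_lhs => rw [← hz, fibreCard_insert hzT, hz]
        conv_rhs => rw [← hs, fibreCard_insert hT.1, hs]
      · rw [fibreCard_insert_of_ne (by rwa [hz]), fibreCard_insert_of_ne (by rwa [hs])]
    have h3 := hQR hT.2
    refine ⟨⟨?_, fun y => ?_⟩, fun y hy => ?_⟩
    · rw [card_insert_of_notMem hzT, ← h3.1.1, card_insert_of_notMem hT.1]
    · rw [hcard]
      exact h3.1.2 y
    · rw [hcard]
      exact h3.2 y hy

/-- Exactness of the bounded Koszul complex below the top degree. -/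
theorem exists_contractLeft_coordSum_eq [Fintype X] (z : X → S) (hz : ∀ x, π (z x) = x)
    {a : X → ℕ} {n : ℕ} (hn : n < ∑ x, a x) {w : ExteriorAlgebra ℤ A}
    (hw : w ∈ wedgeSpan b (boundedSets π a n)) (hdw : contractLeft (coordSum b) w = 0) :
    ∃ v ∈ wedgeSpan b (boundedSets π a (n + 1)), contractLeft (coordSum b) v = w := by
  have key : ∀ Y : Finset X, ∃ v ∈ wedgeSpan b (boundedSets π a (n + 1)),
      w - contractLeft (coordSum b) v ∈
        wedgeSpan b (boundedSets π a n ∩ {T | ∀ y ∈ (Y : Set X), fibreCard π T y = a y}) := by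
    intro Y
    induction Y using Finset.induction_on with
    | empty => exact ⟨0, Submodule.zero_mem _, by simpa using hw⟩
    | insert x Y hx ih =>
      obtain ⟨v, hv, hvw⟩ := ih
      obtain ⟨v', hv', hvw'⟩ := exists_fibreCard_eq_step (by simpa using hx) (hz x) hvw
        (by rw [map_sub, hdw, contractLeft_contractLeft, sub_zero])
      exact ⟨v + v', Submodule.add_mem _ hv hv', by
        rw [map_add, ← sub_sub, coe_insert]; exact hvw'⟩
  -- Once every fibre has been treated, the remainder is supported on sets with exactly `a x`
  -- elements over each `x`. Their size is `∑ a > n`, so there are none of size `n`.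
  obtain ⟨v, hv, hvw⟩ := key univ
  refine ⟨v, hv, (sub_eq_zero.1 ?_).symm⟩
  rw [← wedgeProj_eq_self hvw subset_rfl]
  refine wedgeProj_eq_zero hvw fun T hT _ => ?_
  have h1 : #T = ∑ x, a x := by
    rw [← sum_fibreCard π T]
    exact sum_congr rfl fun x _ => hT.2 x (by simp)
  have h2 := hT.1.1
  omega

end Exactness

/-! ### The bounded Koszul complex, summed over all bounds, with its group action. -/

section KoszulChain

open ExteriorAlgebra CliffordAlgebra

/-- For a rank-one perturbation of the identity, all terms of higher order in `z` vanish because `z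
∧ z = 0`. It shows that elements contracted to zero by `φ` are fixed by the induced map. -/
theorem map_sub_smulRight {M : Type*} [AddCommGroup M] (φ : Module.Dual ℤ M) {z : M}
    (w : ExteriorAlgebra ℤ M) :
    ExteriorAlgebra.map (LinearMap.id - φ.smulRight z) w =
      w - ExteriorAlgebra.ι ℤ z * contractLeft φ w := by
  induction w using CliffordAlgebra.left_induction with
  | algebraMap r => rw [AlgHom.commutes, contractLeft_algebraMap, mul_zero, sub_zero]
  | add x y hx hy => simp only [map_add, hx, hy, mul_add]; abel
  | ι_mul u v hu =>
    rw [map_mul, hu, contractLeft_ι_mul]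
    have h1 : ExteriorAlgebra.map (LinearMap.id - φ.smulRight z) (ExteriorAlgebra.ι ℤ v) =
        ExteriorAlgebra.ι ℤ v - φ v • ExteriorAlgebra.ι ℤ z := by
      rw [ExteriorAlgebra.map_apply_ι]
      simp
    have h2 : ExteriorAlgebra.ι ℤ v * ExteriorAlgebra.ι ℤ z =
        -(ExteriorAlgebra.ι ℤ z * ExteriorAlgebra.ι ℤ v) :=
      eq_neg_of_add_eq_zero_left (ι_add_mul_swap (R := ℤ) v z)
    erw [h1]
    rw [sub_mul, mul_sub, mul_sub, mul_sub, smul_mul_assoc, smul_mul_assoc, ← mul_assoc, ← mul_assoc,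
      ← mul_assoc, h2, ι_sq_zero, zero_mul, smul_zero, mul_smul_comm, neg_mul]
    abel

variable {S X A : Type*} [DecidableEq X] {π : S → X} [LinearOrder S] [AddCommGroup A]
  {b : Module.Basis S ℤ A}

theorem basis_empty : b.ExteriorAlgebra ∅ = 1 := by
  obtain ⟨l, -, hl, h⟩ := exists_list_basis_eq b ∅
  rw [h, (List.toFinset_eq_empty_iff l).1 hl]
  simp [wedgeList]

theorem wedgeSpan_card (n : ℕ) : wedgeSpan b {T | #T = n} = ⋀[ℤ]^n A := by
  apply le_antisymm
  · rw [wedgeSpan, Submodule.span_le]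
    rintro _ ⟨T, rfl, rfl⟩
    rw [SetLike.mem_coe, ExteriorAlgebra.basis_apply]
    exact ExteriorAlgebra.ιMulti_range ℤ _ ⟨_, rfl⟩
  · rw [← exteriorPower.ιMulti_family_span_fixedDegree_of_span ℤ b.span_eq, Submodule.span_le]
    rintro _ ⟨s, rfl⟩
    rw [SetLike.mem_coe, ← ExteriorAlgebra.basis_apply_powersetCard]
    exact basis_mem_wedgeSpan s.2

theorem map_mem_exteriorPower {M N : Type*} [AddCommGroup M] [AddCommGroup N] (f : M →ₗ[ℤ] N)
    {n : ℕ} {w : ExteriorAlgebra ℤ M} (hw : w ∈ ⋀[ℤ]^n M) :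
    ExteriorAlgebra.map f w ∈ ⋀[ℤ]^n N := by
  rw [← ExteriorAlgebra.ιMulti_span_fixedDegree] at hw
  refine (Submodule.span_le (p := (⋀[ℤ]^n N).comap (ExteriorAlgebra.map f).toLinearMap)).2 ?_ hw
  rintro _ ⟨v, rfl⟩
  rw [SetLike.mem_coe, Submodule.mem_comap, AlgHom.toLinearMap_apply,
    ExteriorAlgebra.map_apply_ιMulti]
  exact ExteriorAlgebra.ιMulti_range ℤ _ ⟨_, rfl⟩

section Equivariance

variable {τ : Equiv.Perm S} {σ : Equiv.Perm X} (hπ : ∀ s, π (τ s) = σ (π s))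
include hπ

theorem fibreCard_map (T : Finset S) (x : X) :
    fibreCard π (T.map τ.toEmbedding) (σ x) = fibreCard π T x := by
  rw [fibreCard, fibreCard, filter_map, card_map]
  congr 1
  ext s
  simp [hπ]

theorem map_mem_boundedSets_iff {a : X → ℕ} {n : ℕ} {T : Finset S} :
    T.map τ.toEmbedding ∈ boundedSets π a n ↔ T ∈ boundedSets π (a ∘ σ) n := by
  simp only [boundedSets, Set.mem_ofPred_eq, card_map, Function.comp_apply]
  rw [← σ.forall_congr_right]
  simp only [fibreCard_map hπ]

end Equivariance

variable {p : ℕ} 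

/-- The chain module of the bounded Koszul complex. -/
abbrev KoszulModule (p : ℕ) (X A : Type*) [AddCommGroup A] : Type _ :=
  (X → Fin p) → ExteriorAlgebra ℤ A

/-- The diagonal action on `KoszulModule`. -/
noncomputable def koszulShift (p : ℕ) (σ : Equiv.Perm X) (f : A →ₗ[ℤ] A) :
    Module.End ℤ (KoszulModule p X A) :=
  LinearMap.pi fun a => (ExteriorAlgebra.map f).toLinearMap ∘ₗ LinearMap.proj (a ∘ σ)

theorem koszulShift_apply (σ : Equiv.Perm X) (f : A →ₗ[ℤ] A) (w : KoszulModule p X A)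
    (a : X → Fin p) : koszulShift p σ f w a = ExteriorAlgebra.map f (w (a ∘ σ)) := rfl

theorem koszulShift_pow_apply (σ : Equiv.Perm X) (f : Module.End ℤ A) (n : ℕ)
    (w : KoszulModule p X A) (a : X → Fin p) :
    (koszulShift p σ f ^ n) w a = ExteriorAlgebra.map (f ^ n) (w (a ∘ (σ ^ n : Equiv.Perm X))) := by
  induction n generalizing a with
  | zero =>
    simp only [pow_zero, Module.End.one_apply, Equiv.Perm.coe_one, Function.comp_id]
    exact (congrArg (fun g => g (w a)) ExteriorAlgebra.map_id).symm
  | succ n ih =>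
    rw [pow_succ', Module.End.mul_apply, koszulShift_apply, ih]
    have := congrArg (fun g => g (w (a ∘ (σ ^ (n + 1) : Equiv.Perm X))))
      (ExteriorAlgebra.map_comp_map (f ^ n) f)
    rw [pow_succ' f, Module.End.mul_eq_comp, ← this, pow_succ' σ]
    rfl

variable [Fintype X]

variable (b p X) in
/-- The basis of `KoszulModule`. -/
noncomputable def koszulBasis :
    Module.Basis ((X → Fin p) × Finset S) ℤ (KoszulModule p X A) :=
  (Pi.basis fun _ : X → Fin p => b.ExteriorAlgebra).reindex (Equiv.sigmaEquivProd _ _)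

theorem koszulBasis_apply (i : (X → Fin p) × Finset S) :
    koszulBasis X b p i = Pi.single i.1 (b.ExteriorAlgebra i.2) := by
  simp [koszulBasis]

theorem koszulShift_single (σ : Equiv.Perm X) (f : A →ₗ[ℤ] A) (a : X → Fin p)
    (v : ExteriorAlgebra ℤ A) :
    koszulShift p σ f (Pi.single a v) =
      Pi.single (a ∘ σ.symm) (ExteriorAlgebra.map f v) := by
  funext a'
  rw [koszulShift_apply]
  by_cases h : a' ∘ σ = a
  · subst h
    have : a' ∘ σ ∘ σ.symm = a' := by simp
    rw [Function.comp_assoc, this, Pi.single_eq_same, Pi.single_eq_same]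
  · rw [Pi.single_eq_of_ne h, Pi.single_eq_of_ne, map_zero]
    rintro rfl
    exact h (by funext x; simp)

/-- The permutation of the index set of `koszulBasis` underlying `koszulShift`. -/
def koszulPerm (p : ℕ) (τ : Equiv.Perm S) (σ : Equiv.Perm X) :
    Equiv.Perm ((X → Fin p) × Finset S) :=
  Equiv.prodCongr (σ.arrowCongr (Equiv.refl _)) τ.finsetCongr

theorem koszulPerm_apply (τ : Equiv.Perm S) (σ : Equiv.Perm X) (i : (X → Fin p) × Finset S) :
    koszulPerm p τ σ i = (i.1 ∘ σ.symm, i.2.map τ.toEmbedding) := rfl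

theorem koszulPerm_pow_apply (τ : Equiv.Perm S) (σ : Equiv.Perm X) (n : ℕ)
    (i : (X → Fin p) × Finset S) :
    (koszulPerm p τ σ ^ n) i =
      (i.1 ∘ (σ ^ n : Equiv.Perm X).symm, i.2.map (τ ^ n : Equiv.Perm S).toEmbedding) := by
  induction n with
  | zero =>
    simp only [pow_zero, Equiv.Perm.one_apply]
    refine Prod.ext (by funext x; rfl) ?_
    exact (map_refl (s := i.2)).symm
  | succ n ih =>
    rw [pow_succ', Equiv.Perm.mul_apply, ih, koszulPerm_apply]
    refine Prod.ext ?_ ?_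
    · rw [pow_succ' σ]; rfl
    · rw [pow_succ' τ, map_map]; rfl

variable (π) in
/-- The index set of the part of the bounded Koszul complex of total degree `j` and exterior
degree `n`. -/
def koszulIndex (p j n : ℕ) : Set ((X → Fin p) × Finset S) :=
  {i | ∑ x, (i.1 x : ℕ) = j ∧ i.2 ∈ boundedSets π (fun x => (i.1 x : ℕ)) n}

variable (b π) in
/-- The part of the bounded Koszul complex of total degree `j` and exterior degree `n`. -/
noncomputable def koszulChain (p j n : ℕ) : Submodule ℤ (KoszulModule p X A) :=
  Submodule.span ℤ (koszulBasis X b p '' koszulIndex π p j n)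

theorem mem_koszulChain_iff {j n : ℕ} {w : KoszulModule p X A} :
    w ∈ koszulChain π b p j n ↔
      ∀ a, w a ∈ wedgeSpan b {T | (a, T) ∈ koszulIndex π p j n} := by
  constructor
  · intro hw a
    refine mem_of_mem_span_basis (p := (wedgeSpan b {T | (a, T) ∈ koszulIndex π p j n}).comap
      (LinearMap.proj a)) (fun i hi => ?_) hw
    rw [Submodule.mem_comap, koszulBasis_apply, LinearMap.proj_apply]
    by_cases h : a = i.1
    · subst h
      rw [Pi.single_eq_same]
      exact basis_mem_wedgeSpan hi
    · rw [Pi.single_eq_of_ne h]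
      exact Submodule.zero_mem _
  · intro h
    rw [← univ_sum_single w]
    refine Submodule.sum_mem _ fun a _ => ?_
    refine mem_of_mem_span_basis (p := (koszulChain π b p j n).comap
      (LinearMap.single ℤ (fun _ => ExteriorAlgebra ℤ A) a)) (fun T hT => ?_) (h a)
    exact Submodule.subset_span ⟨(a, T), hT, koszulBasis_apply _⟩

end KoszulChain

/-! ### Vanishing for the cycles, and the exterior power of the kernel as a retract of the top
cycles. -/

section KoszulVanishing

open ExteriorAlgebra CliffordAlgebra

variable {S X A : Type*} [DecidableEq X] {π : S → X} [LinearOrder S] [AddCommGroup A]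
  {b : Module.Basis S ℤ A} {p m j : ℕ} [Fintype X] {f : Module.End ℤ A}
  {τ : Equiv.Perm S} {σ : Equiv.Perm X}

theorem koszulShift_basis (hf : ∀ s, f (b s) = b (τ s)) (i : (X → Fin p) × Finset S) :
    ∃ u : ℤˣ, koszulShift p σ f (koszulBasis X b p i) =
      u • koszulBasis X b p (koszulPerm p τ σ i) := by
  obtain ⟨u, hu⟩ := map_basis b hf i.2
  refine ⟨u, ?_⟩
  rw [koszulBasis_apply, koszulBasis_apply, koszulShift_single, hu, Units.smul_def, Units.smul_def,
    ← Pi.single_smul]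
  rfl

theorem koszulPerm_mem (hπ : ∀ s, π (τ s) = σ (π s)) {n : ℕ} {i : (X → Fin p) × Finset S}
    (hi : i ∈ koszulIndex π p j n) : koszulPerm p τ σ i ∈ koszulIndex π p j n := by
  refine ⟨?_, ?_⟩
  · rw [← hi.1]
    exact Equiv.sum_comp σ.symm fun x => (i.1 x : ℕ)
  · rw [koszulPerm_apply]
    refine (map_mem_boundedSets_iff hπ).2 ?_
    have : (fun x => ((i.1 ∘ σ.symm) x : ℕ)) ∘ σ = fun x => (i.1 x : ℕ) := by
      funext x
      simp
    rw [this]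
    exact hi.2

theorem koszulShift_mem (hπ : ∀ s, π (τ s) = σ (π s)) (hf : ∀ s, f (b s) = b (τ s)) {n : ℕ}
    (w : KoszulModule p X A) (hw : w ∈ koszulChain π b p j n) :
    koszulShift p σ f w ∈ koszulChain π b p j n := by
  choose u hu using koszulShift_basis (p := p) (σ := σ) hf
  exact stable_span_basis hu (fun i hi => koszulPerm_mem hπ hi) w hw

variable (p X) in
/-- The differential of the bounded Koszul complex. -/
noncomputable def koszulDiff [Fintype S] (b : Module.Basis S ℤ A) :
    Module.End ℤ (KoszulModule p X A) :=
  LinearMap.pi fun a => contractLeft (coordSum b) ∘ₗ LinearMap.proj a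

variable [Fintype S]

theorem koszulDiff_apply (w : KoszulModule p X A) (a : X → Fin p) :
    koszulDiff X p b w a = contractLeft (coordSum b) (w a) := rfl

theorem koszulDiff_koszulShift (hf : ∀ s, f (b s) = b (τ s)) (w : KoszulModule p X A) :
    koszulDiff X p b (koszulShift p σ f w) = koszulShift p σ f (koszulDiff X p b w) := by
  funext a
  have : coordSum b ∘ₗ f = coordSum b := b.ext fun s => by
    rw [LinearMap.comp_apply, hf, coordSum_basis, coordSum_basis]
  rw [koszulDiff_apply, koszulShift_apply, koszulShift_apply, koszulDiff_apply, contractLeft_map,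
    this]

variable (π p b) in
/-- The cycles of the bounded Koszul complex. -/
noncomputable def koszulCycles (j n : ℕ) : Submodule ℤ (KoszulModule p X A) :=
  koszulChain π b p j n ⊓ LinearMap.ker (koszulDiff X p b)

theorem koszulCycles_stable (hπ : ∀ s, π (τ s) = σ (π s)) (hf : ∀ s, f (b s) = b (τ s)) {n : ℕ}
    (w : KoszulModule p X A) (hw : w ∈ koszulCycles π b p j n) :
    koszulShift p σ f w ∈ koszulCycles π b p j n := by
  refine ⟨koszulShift_mem hπ hf w hw.1, ?_⟩
  rw [SetLike.mem_coe, LinearMap.mem_ker, koszulDiff_koszulShift hf, LinearMap.mem_ker.1 hw.2,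
    map_zero]

theorem koszulDiff_mem {n : ℕ} {w : KoszulModule p X A} (hw : w ∈ koszulChain π b p j (n + 1)) :
    koszulDiff X p b w ∈ koszulCycles π b p j n := by
  refine ⟨mem_koszulChain_iff.2 fun a => contractLeft_coordSum_mem (fun T hT s hs => ?_)
    (mem_koszulChain_iff.1 hw a), ?_⟩
  · refine ⟨hT.1, by rw [card_erase_of_mem hs, hT.2.1]; rfl, fun x => ?_⟩
    exact (card_le_card (filter_subset_filter _ (erase_subset _ _))).trans (hT.2.2 x)
  · rw [SetLike.mem_coe, LinearMap.mem_ker]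
    funext a
    exact contractLeft_contractLeft _ _

theorem exists_koszulDiff_eq {z : X → S} (hz : ∀ x, π (z x) = x) {n : ℕ} (hn : n < j)
    {w : KoszulModule p X A} (hw : w ∈ koszulCycles π b p j n) :
    ∃ v ∈ koszulChain π b p j (n + 1), koszulDiff X p b v = w := by
  have h : ∀ a, ∃ v ∈ wedgeSpan b {T | (a, T) ∈ koszulIndex π p j (n + 1)},
      contractLeft (coordSum b) v = w a := by
    intro a
    have hwa := mem_koszulChain_iff.1 hw.1 a
    by_cases ha : ∑ x, (a x : ℕ) = j
    · obtain ⟨v, hv, hvw⟩ := exists_contractLeft_coordSum_eq (a := fun x => (a x : ℕ)) z hz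
        (by rwa [ha]) (wedgeSpan_mono (fun T hT => And.right hT) hwa)
        (congrFun (LinearMap.mem_ker.1 hw.2) a)
      exact ⟨v, wedgeSpan_mono (fun T hT => (⟨ha, hT⟩ : (a, T) ∈ koszulIndex π p j (n + 1))) hv, hvw⟩
    · refine ⟨0, Submodule.zero_mem _, ?_⟩
      have : {T | (a, T) ∈ koszulIndex π p j n} = ∅ :=
        Set.eq_empty_of_forall_notMem fun T hT => ha hT.1
      rw [this, wedgeSpan, Set.image_empty, Submodule.span_empty, Submodule.mem_bot] at hwa
      rw [map_zero, hwa]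
  choose v hv hvw using h
  exact ⟨v, mem_koszulChain_iff.2 hv, funext hvw⟩

/-- Induction on the degree along the short exact sequences `Z_(n+1) → C_(n+1) → Z_n`. The middle
term is free up to signs, and the start `Z_0 = C_0` is a permutation module whose basis vectors
involve only the empty wedge, so no signs appear. -/
theorem tateVanishes_koszulCycles (hπ : ∀ s, π (τ s) = σ (π s)) (hf : ∀ s, f (b s) = b (τ s))
    {z : X → S} (hz : ∀ x, π (z x) = x) (hm : m ≠ 0) (hτ : τ ^ m = 1)
    (hfree : ∀ T : Finset S, T.Nonempty → (∀ x, fibreCard π T x < p) →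
      ∀ n, T.map (τ ^ n : Equiv.Perm S).toEmbedding = T → m ∣ n) {n : ℕ} (hn : n ≤ j) :
    TateVanishes (koszulShift p σ f) m n (koszulCycles π b p j n) := by
  have hσ : σ ^ m = 1 := by
    have h : ∀ (n : ℕ) s, π ((τ ^ n : Equiv.Perm S) s) = (σ ^ n : Equiv.Perm X) (π s) := by
      intro n
      induction n with
      | zero => simp
      | succ n ih =>
        intro s
        rw [pow_succ', pow_succ', Equiv.Perm.mul_apply, Equiv.Perm.mul_apply, hπ, ih]
    ext x
    rw [← hz x, ← h, hτ]
    rfl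
  have hfm : f ^ m = 1 := b.ext fun s => by
    have h : ∀ n : ℕ, (f ^ n) (b s) = b ((τ ^ n : Equiv.Perm S) s) := by
      intro n
      induction n with
      | zero => simp
      | succ n ih => rw [pow_succ', pow_succ', Module.End.mul_apply, ih, hf, Equiv.Perm.mul_apply]
    rw [h, hτ]
    rfl
  have htm : koszulShift p σ f ^ m = 1 := by
    refine LinearMap.ext fun w => funext fun a => ?_
    rw [koszulShift_pow_apply, hσ, hfm, Equiv.Perm.coe_one, Function.comp_id]
    exact congrArg (fun g => g (w a)) ExteriorAlgebra.map_id
  have hperm : koszulPerm p τ σ ^ m = 1 := by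
    refine Equiv.ext fun i => ?_
    rw [koszulPerm_pow_apply, hτ, hσ]
    exact Prod.ext rfl (map_refl (s := i.2))
  choose u hu using koszulShift_basis (p := p) (σ := σ) hf
  induction n with
  | zero =>
    have h0 : ∀ i ∈ koszulIndex π p j 0, i.2 = ∅ := fun i hi => card_eq_zero.1 hi.2.1
    have hZ : koszulCycles π b p j 0 = koszulChain π b p j 0 := by
      refine inf_eq_left.2 fun w hw => ?_
      refine mem_of_mem_span_basis (fun i hi => ?_) hw
      rw [LinearMap.mem_ker, koszulBasis_apply, h0 i hi, basis_empty]
      funext a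
      rw [koszulDiff_apply]
      by_cases ha : a = i.1
      · subst ha
        rw [Pi.single_eq_same, contractLeft_one]
        rfl
      · rw [Pi.single_eq_of_ne ha, map_zero]
        rfl
    rw [hZ]
    refine ⟨fun _ => TateNegVanishes.of_permutation (τ := koszulPerm p τ σ) (fun i hi => ?_)
      (fun i hi => koszulPerm_mem hπ hi) hm hperm, fun h => absurd h (by simp)⟩
    rw [koszulBasis_apply, koszulBasis_apply, koszulShift_single, koszulPerm_apply, h0 i hi,
      map_empty, basis_empty, map_one]
  | succ n ih =>
    have hfree' : ∀ i ∈ koszulIndex π p j (n + 1), ∀ k, (koszulPerm p τ σ ^ k) i = i → m ∣ k := by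
      intro i hi k hk
      rw [koszulPerm_pow_apply] at hk
      refine hfree i.2 (card_pos.1 (by rw [hi.2.1]; omega)) (fun x => ?_) k (congrArg Prod.snd hk)
      exact (hi.2.2 x).trans_lt (i.1 x).2
    refine (ih (by omega)).succ (W := koszulChain π b p j (n + 1))
      (TateNegVanishes.of_free_monomial hu (fun i hi => koszulPerm_mem hπ hi) hm htm hperm hfree')
      (TateZeroVanishes.of_free_monomial hu hm htm hperm hfree')
      (koszulShift_mem hπ hf) (fun w _ => by rw [htm]; rfl) (koszulDiff X p b)
      (fun w _ => koszulDiff_koszulShift hf w) (fun w => ?_) (fun w hw => koszulDiff_mem hw)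
      (fun w hw => exists_koszulDiff_eq hz (by omega) hw)
    rw [koszulCycles, Submodule.mem_inf, LinearMap.mem_ker]

variable (π) in
/-- The index sets with fibres of size `a`. -/
def exactSets (a : X → ℕ) : Set (Finset S) := {T | ∀ x, fibreCard π T x = a x}

/-- Contraction by the fibre sum over `x` is homogeneous for the fibre counts, so it annihilates
homogeneous parts separately. -/
theorem contractLeft_fibreSum_wedgeProj {w : ExteriorAlgebra ℤ A} {x : X}
    (hw : contractLeft (fibreSum π b x) w = 0) {Q Q' : Set (Finset S)}
    (h : ∀ T, ∀ s ∈ T, π s = x → (T.erase s ∈ Q' ↔ T ∈ Q)) :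
    contractLeft (fibreSum π b x) (wedgeProj b Q w) = 0 := by
  have h1 : wedgeProj b Q' (contractLeft (fibreSum π b x) w) = 0 := by rw [hw, map_zero]
  rw [contractLeft_fibreSum, map_sum] at h1
  rw [contractLeft_fibreSum, ← h1]
  refine sum_congr rfl fun s hs => ?_
  rw [wedgeProj_contractLeft_coord fun T hsT => h T s hsT (by simpa using hs)]

/-- A set containing the whole fibre contains `z`, so `b z ∧ w' = 0` for the full-fibre part `w'`.
Contracting this by the fibre sum returns `w'` itself. Thus the bound `a x < p` loses nothing of the
exterior power of the kernel. -/
theorem wedgeProj_fullFibre_eq_zero {w : ExteriorAlgebra ℤ A} {x : X}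
    (hw : contractLeft (fibreSum π b x) w = 0) {z : S} (hz : π z = x)
    (hp : #{s | π s = x} = p) :
    wedgeProj b {T | fibreCard π T x = p} w = 0 := by
  set w' := wedgeProj b {T | fibreCard π T x = p} w with hw'
  have h1 : contractLeft (fibreSum π b x) w' = 0 := by
    refine contractLeft_fibreSum_wedgeProj hw (Q' := {T | fibreCard π T x + 1 = p}) ?_
    intro T s hsT hs
    have := fibreCard_erase_add_one (π := π) hsT
    rw [hs] at this
    simp only [Set.mem_ofPred_eq, this]
  have h2 : ExteriorAlgebra.ι ℤ (b z) * w' = 0 := by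
    refine eq_of_eq_on_wedgeSpan (f := LinearMap.mulLeft ℤ (ExteriorAlgebra.ι ℤ (b z))) (g := 0)
      (fun T hT => ?_) (wedgeProj_mem {T | fibreCard π T x = p} w)
    rw [LinearMap.mulLeft_apply, ι_mul_basis_of_mem b, LinearMap.zero_apply]
    have hT : fibreCard π T x = p := hT
    have : ({s ∈ T | π s = x} : Finset S) = ({s | π s = x} : Finset S) :=
      eq_of_subset_of_card_le (filter_subset_filter _ (subset_univ _))
        (by rw [hp, ← hT, fibreCard])
    have hz' : z ∈ ({s ∈ T | π s = x} : Finset S) := by rw [this]; simpa using hz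
    exact (mem_filter.1 hz').1
  have h3 := congrArg (contractLeft (fibreSum π b x)) h2
  rw [contractLeft_ι_mul, h1, mul_zero, sub_zero, fibreSum_basis, if_pos hz, one_smul,
    map_zero] at h3
  exact h3

theorem mem_wedgeSpan_of_contractLeft_fibreSum {w : ExteriorAlgebra ℤ A}
    (hw : ∀ x, contractLeft (fibreSum π b x) w = 0) {z : X → S} (hz : ∀ x, π (z x) = x)
    (hp : ∀ x, #{s | π s = x} = p) {Q : Set (Finset S)} (hQ : w ∈ wedgeSpan b Q) (Y : Finset X) :
    w ∈ wedgeSpan b (Q ∩ {T | ∀ x ∈ Y, fibreCard π T x < p}) := by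
  induction Y using Finset.induction_on with
  | empty => simpa using hQ
  | insert x Y _ ih =>
    have h1 : wedgeProj b {T | fibreCard π T x = p}ᶜ w = w := by
      have := wedgeProj_add_compl (b := b) {T | fibreCard π T x = p} w
      rwa [wedgeProj_fullFibre_eq_zero (hw x) (hz x) (hp x), zero_add] at this
    rw [← h1]
    refine wedgeSpan_mono ?_ (wedgeProj_mem_inter ih _)
    rintro T ⟨⟨hT, hT'⟩, hTx⟩
    refine ⟨hT, fun y hy => ?_⟩
    rcases mem_insert.1 hy with rfl | hy
    · have h2 : fibreCard π T y ≤ p := by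
        rw [← hp y]
        exact card_le_card (filter_subset_filter _ (subset_univ _))
      exact lt_of_le_of_ne h2 hTx
    · exact hT' y hy

variable (π b) in
/-- The projection along the chosen points `z` to the common kernel of the fibre sums over `Y`. -/
noncomputable def fibreProj (z : X → S) (Y : Finset X) : Module.End ℤ A :=
  LinearMap.id - ∑ x ∈ Y, (fibreSum π b x).smulRight (b (z x))

theorem fibreSum_fibreProj {z : X → S} (hz : ∀ x, π (z x) = x) (Y : Finset X) (x : X) (v : A) :
    fibreSum π b x (fibreProj π b z Y v) = if x ∈ Y then 0 else fibreSum π b x v := by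
  simp only [fibreProj, LinearMap.sub_apply, LinearMap.id_apply, LinearMap.sum_apply,
    LinearMap.smulRight_apply, map_sub, map_sum, map_smul, fibreSum_basis, hz, smul_eq_mul,
    mul_ite, mul_one, mul_zero, sum_ite_eq']
  split_ifs <;> simp

/-- The projection is a composite of rank-one perturbations of the identity, one for each point of
`Y`, so `map_sub_smulRight` applies. For `Y = univ` it shows that elements killed by all fibre
contractions come from the exterior algebra of the common kernel. -/
theorem map_fibreProj {z : X → S} (hz : ∀ x, π (z x) = x) {w : ExteriorAlgebra ℤ A}
    (hw : ∀ x, contractLeft (fibreSum π b x) w = 0) (Y : Finset X) :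
    ExteriorAlgebra.map (fibreProj π b z Y) w = w := by
  induction Y using Finset.induction_on with
  | empty =>
    have : fibreProj π b z ∅ = LinearMap.id := by simp [fibreProj]
    rw [this]
    exact congrArg (fun g => g w) ExteriorAlgebra.map_id
  | insert x Y hx ih =>
    have h : fibreProj π b z (insert x Y) =
        (LinearMap.id - (fibreSum π b x).smulRight (b (z x))) ∘ₗ fibreProj π b z Y := by
      refine LinearMap.ext fun v => ?_
      rw [LinearMap.comp_apply, LinearMap.sub_apply, LinearMap.smulRight_apply,
        fibreSum_fibreProj hz, if_neg hx]
      simp only [fibreProj, sum_insert hx, LinearMap.sub_apply, LinearMap.id_apply,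
        LinearMap.add_apply, LinearMap.smulRight_apply]
      abel
    rw [h, ← ExteriorAlgebra.map_comp_map, AlgHom.comp_apply, ih, map_sub_smulRight, hw, mul_zero,
      sub_zero]

variable (π p j) in
/-- The embedding of the exterior power into the top term of the bounded Koszul complex. -/
noncomputable def toKoszul (b : Module.Basis S ℤ A) :
    ExteriorAlgebra ℤ A →ₗ[ℤ] KoszulModule p X A :=
  LinearMap.pi fun a => wedgeProj b
    {T | ∑ x, (a x : ℕ) = j ∧ T ∈ exactSets π fun x => (a x : ℕ)}

theorem toKoszul_apply (w : ExteriorAlgebra ℤ A) (a : X → Fin p) :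
    toKoszul π p j b w a = wedgeProj b
      {T | ∑ x, (a x : ℕ) = j ∧ T ∈ exactSets π fun x => (a x : ℕ)} w := rfl

theorem toKoszul_mem {w : ExteriorAlgebra ℤ A} (hw : ∀ x, contractLeft (fibreSum π b x) w = 0) :
    toKoszul π p j b w ∈ koszulCycles π b p j j := by
  refine ⟨mem_koszulChain_iff.2 fun a => wedgeSpan_mono ?_ (wedgeProj_mem _ _), ?_⟩
  · rintro T ⟨ha, hT⟩
    refine ⟨ha, ?_, fun x => (hT x).le⟩
    rw [← ha, ← sum_fibreCard π T]
    exact sum_congr rfl fun x _ => hT x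
  · rw [SetLike.mem_coe, LinearMap.mem_ker]
    funext a
    have hsum : coordSum b = ∑ x, fibreSum π b x := b.ext fun s => by
      simp [coordSum_basis, LinearMap.sum_apply, fibreSum_basis]
    rw [koszulDiff_apply, toKoszul_apply, hsum, map_sum, LinearMap.sum_apply]
    refine sum_eq_zero fun x _ => contractLeft_fibreSum_wedgeProj (hw x)
      -- The fibre counts after removal of one element over `x`.
      (Q' := {T | ∑ x, (a x : ℕ) = j ∧ fibreCard π T x + 1 = a x ∧
        ∀ y, y ≠ x → fibreCard π T y = a y}) ?_
    intro T s hsT hs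
    have h1 := fibreCard_erase_add_one (π := π) hsT
    rw [hs] at h1
    have h2 : ∀ y, y ≠ x → fibreCard π (T.erase s) y = fibreCard π T y := fun y hy =>
      fibreCard_erase_of_ne (by rw [hs]; exact hy.symm) T
    simp only [Set.mem_ofPred_eq, exactSets, h1]
    refine and_congr_right fun _ => ⟨fun ⟨h3, h4⟩ y => ?_, fun h3 => ⟨h3 x, fun y hy => ?_⟩⟩
    · by_cases hy : y = x
      · rw [hy, h3]
      · rw [← h2 y hy, h4 y hy]
    · rw [h2 y hy, h3]

theorem sum_toKoszul {w : ExteriorAlgebra ℤ A}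
    (hw : w ∈ wedgeSpan b ({T | #T = j} ∩ {T | ∀ x ∈ univ, fibreCard π T x < p})) :
    ∑ a, toKoszul π p j b w a = w := by
  have := eq_of_eq_on_wedgeSpan (f := ∑ a, LinearMap.proj a ∘ₗ toKoszul π p j b)
    (g := LinearMap.id) (fun T hT => ?_) hw
  · simpa [LinearMap.sum_apply] using this
  have hT2 : ∀ x, fibreCard π T x < p := fun x => hT.2 x (mem_univ x)
  rw [LinearMap.sum_apply, sum_eq_single (fun x => (⟨fibreCard π T x, hT2 x⟩ : Fin p))]
  · rw [LinearMap.comp_apply, LinearMap.proj_apply, toKoszul_apply, wedgeProj_of_mem]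
    · rfl
    · exact ⟨(sum_fibreCard π T).trans hT.1, fun x => rfl⟩
  · intro a _ ha
    rw [LinearMap.comp_apply, LinearMap.proj_apply, toKoszul_apply, wedgeProj_of_notMem]
    rintro ⟨-, h⟩
    exact ha (funext fun x => Fin.ext (h x).symm)
  · exact fun h => absurd (mem_univ _) h

/-- In top degree `#T = j = ∑ a` together with the bounds forces all fibre counts to equal `a`. The
vanishing of the total contraction then splits by fibre. -/
theorem contractLeft_fibreSum_of_mem_koszulCycles {w : KoszulModule p X A}
    (hw : w ∈ koszulCycles π b p j j) (a : X → Fin p) (x : X) :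
    contractLeft (fibreSum π b x) (w a) = 0 := by
  have hwa := mem_koszulChain_iff.1 hw.1 a
  have hda : contractLeft (coordSum b) (w a) = 0 := congrFun (LinearMap.mem_ker.1 hw.2) a
  have hex : ∀ T, (a, T) ∈ koszulIndex π p j j → fibreCard π T x = a x := by
    intro T hT
    have h1 : ∑ y, fibreCard π T y = ∑ y, (a y : ℕ) := by rw [sum_fibreCard, hT.1, hT.2.1]
    exact (sum_eq_sum_iff_of_le fun y _ => hT.2.2 y).1 h1 x (mem_univ x)
  have h := contractLeft_coordSum_fibreCard_eq (a := fun x => (a x : ℕ)) (x := x)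
    (fun T hT => (hex T hT).le) hwa hda
  rw [wedgeProj_eq_self (Q' := {T | fibreCard π T x = a x}) hwa fun T hT => hex T hT, hda] at h
  exact h.symm

theorem toKoszul_map (hπ : ∀ s, π (τ s) = σ (π s)) (hf : ∀ s, f (b s) = b (τ s))
    (w : ExteriorAlgebra ℤ A) :
    toKoszul π p j b (ExteriorAlgebra.map f w) = koszulShift p σ f (toKoszul π p j b w) := by
  funext a
  rw [koszulShift_apply, toKoszul_apply, toKoszul_apply]
  refine wedgeProj_map hf (fun T => ?_) w
  have h1 : ∑ x, ((a ∘ σ) x : ℕ) = ∑ x, (a x : ℕ) := Equiv.sum_comp σ fun x => (a x : ℕ)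
  simp only [Set.mem_ofPred_eq, h1, exactSets]
  refine and_congr_right fun _ => ?_
  rw [← σ.forall_congr_right]
  simp only [fibreCard_map hπ, Function.comp_apply]

/-- Vanishing for the exterior powers of the common kernel of the fibre sums. -/
theorem tateVanishes_exteriorPower_of_fibreSum (hπ : ∀ s, π (τ s) = σ (π s))
    (hf : ∀ s, f (b s) = b (τ s)) {z : X → S} (hz : ∀ x, π (z x) = x) (hm : m ≠ 0)
    (hτ : τ ^ m = 1) (hp : ∀ x, #{s | π s = x} = p)
    (hfree : ∀ T : Finset S, T.Nonempty → (∀ x, fibreCard π T x < p) →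
      ∀ n, T.map (τ ^ n : Equiv.Perm S).toEmbedding = T → m ∣ n)
    {K : Type*} [AddCommGroup K] {i : K →ₗ[ℤ] A} (hi : Function.Injective i)
    (hrange : ∀ v, v ∈ LinearMap.range i ↔ ∀ x, fibreSum π b x v = 0) {g : Module.End ℤ K}
    (hg : ∀ k, i (g k) = f (i k)) (j : ℕ) :
    TateVanishes (ExteriorAlgebra.map g).toLinearMap m j (⋀[ℤ]^j K) := by
  have hproj : ∀ v, fibreProj π b z univ v ∈ LinearMap.range i := fun v =>
    (hrange _).2 fun x => by rw [fibreSum_fibreProj hz, if_pos (mem_univ x)]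
  let r : A →ₗ[ℤ] K := (LinearEquiv.ofInjective i hi).symm.toLinearMap ∘ₗ
    (fibreProj π b z univ).codRestrict (LinearMap.range i) hproj
  have hir : i ∘ₗ r = fibreProj π b z univ := by
    refine LinearMap.ext fun v => ?_
    exact congrArg Subtype.val ((LinearEquiv.ofInjective i hi).apply_symm_apply
      ((fibreProj π b z univ).codRestrict (LinearMap.range i) hproj v))
  have hφi : ∀ x, fibreSum π b x ∘ₗ i = 0 := fun x =>
    LinearMap.ext fun k => (hrange (i k)).1 ⟨k, rfl⟩ x
  have hri : r ∘ₗ i = LinearMap.id := by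
    refine LinearMap.ext fun k => hi ?_
    rw [← LinearMap.comp_apply, ← LinearMap.comp_assoc, hir, LinearMap.comp_apply, fibreProj,
      LinearMap.sub_apply, LinearMap.sum_apply, sum_eq_zero, sub_zero]
    · rfl
    · intro x _
      rw [LinearMap.smulRight_apply, (hrange (i k)).1 ⟨k, rfl⟩ x, zero_smul]
  have hgi : i ∘ₗ g = f ∘ₗ i := LinearMap.ext hg
  have hcontr : ∀ x (w : ExteriorAlgebra ℤ K),
      contractLeft (fibreSum π b x) (ExteriorAlgebra.map i w) = 0 := fun x w => by
    rw [contractLeft_map, hφi, map_zero, LinearMap.zero_apply, map_zero]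
  have hmri : ∀ w, ExteriorAlgebra.map r (ExteriorAlgebra.map i w) = w := fun w => by
    rw [← AlgHom.comp_apply, ExteriorAlgebra.map_comp_map, hri, ExteriorAlgebra.map_id]
    rfl
  have hmir : ∀ w, (∀ x, contractLeft (fibreSum π b x) w = 0) →
      ExteriorAlgebra.map i (ExteriorAlgebra.map r w) = w := fun w hw => by
    rw [← AlgHom.comp_apply, ExteriorAlgebra.map_comp_map, hir, map_fibreProj hz hw]
  have hmgi : ∀ w, ExteriorAlgebra.map i (ExteriorAlgebra.map g w) =
      ExteriorAlgebra.map f (ExteriorAlgebra.map i w) := fun w => by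
    rw [← AlgHom.comp_apply, ← AlgHom.comp_apply, ExteriorAlgebra.map_comp_map,
      ExteriorAlgebra.map_comp_map, hgi]
  -- Adding the components over all `a` undoes the decomposition `toKoszul` by fibre counts.
  let s : KoszulModule p X A →ₗ[ℤ] ExteriorAlgebra ℤ A := ∑ a, LinearMap.proj a
  have hs : ∀ w, s w = ∑ a, w a := fun w => by simp [s, LinearMap.sum_apply]
  have hscontr : ∀ w ∈ koszulCycles π b p j j, ∀ x, contractLeft (fibreSum π b x) (s w) = 0 :=
    fun w hw x => by
      rw [hs, map_sum]
      exact sum_eq_zero fun a _ => contractLeft_fibreSum_of_mem_koszulCycles hw a x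
  have hsmap : ∀ w, s (koszulShift p σ f w) = ExteriorAlgebra.map f (s w) := fun w => by
    rw [hs, hs, map_sum]
    exact Equiv.sum_comp (σ.symm.arrowCongr (Equiv.refl (Fin p)))
      fun a => ExteriorAlgebra.map f (w a)
  refine (tateVanishes_koszulCycles hπ hf hz hm hτ hfree le_rfl).of_retract
    (fun w hw => map_mem_exteriorPower g hw) (koszulCycles_stable hπ hf)
    (toKoszul π p j b ∘ₗ (ExteriorAlgebra.map i).toLinearMap)
    ((ExteriorAlgebra.map r).toLinearMap ∘ₗ s) (fun w _ => toKoszul_mem fun x => hcontr x w)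
    (fun w hw => map_mem_exteriorPower r ?_) (fun w _ => ?_) (fun w hw => ?_) (fun w hw => ?_)
  · rw [hs, ← wedgeSpan_card (b := b)]
    exact Submodule.sum_mem _ fun a _ => wedgeSpan_mono (fun T hT => hT.2.1)
      (mem_koszulChain_iff.1 hw.1 a)
  · simp only [LinearMap.comp_apply, AlgHom.toLinearMap_apply]
    rw [hmgi, toKoszul_map hπ hf]
  · simp only [LinearMap.comp_apply, AlgHom.toLinearMap_apply]
    -- The projection `r` depends on the chosen points `z` and need not be equivariant. Equivariance
    -- on cycles is therefore checked after the injective equivariant map `Λ i`, where `Λ i ∘ Λ r`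
    -- acts as the identity.
    have hinj : Function.Injective (ExteriorAlgebra.map i) := Function.LeftInverse.injective hmri
    apply hinj
    rw [hmir _ (hscontr _ (koszulCycles_stable hπ hf w hw)), hsmap, hmgi, hmir _ (hscontr w hw)]
  · simp only [LinearMap.comp_apply, AlgHom.toLinearMap_apply]
    rw [hs, sum_toKoszul, hmri]
    refine mem_wedgeSpan_of_contractLeft_fibreSum (fun x => hcontr x w) hz hp ?_ univ
    rw [wedgeSpan_card]
    exact map_mem_exteriorPower i hw

end KoszulVanishing

/-! ### The cyclic group of order `p^(k+1)` and its subgroup of order `p`. -/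

section CyclicGroupLattice

variable {p k : ℕ}

/-- The reduction `ℤ/p^(k+1) → ℤ/p^k`. -/
def zmodPowCast (p k : ℕ) : ZMod (p ^ (k + 1)) →+* ZMod (p ^ k) :=
  ZMod.castHom (pow_dvd_pow p k.le_succ) _

theorem zmodPowCast_surjective (p k : ℕ) : Function.Surjective (zmodPowCast p k) :=
  ZMod.castHom_surjective _

theorem zmodPowCast_pow (p k : ℕ) : zmodPowCast p k ((p ^ k : ℕ) : ZMod (p ^ (k + 1))) = 0 := by
  rw [map_natCast, ZMod.natCast_self]

theorem natCast_pow_mul_injOn (hp : p.Prime) :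
    Set.InjOn (fun i : ℕ => ((p ^ k * i : ℕ) : ZMod (p ^ (k + 1)))) (range p) := by
  intro i hi i' hi' h
  have h1 : ∀ i ∈ range p, p ^ k * i < p ^ (k + 1) := fun i hi => by
    rw [pow_succ]
    exact Nat.mul_lt_mul_of_pos_left (mem_range.1 hi) (pow_pos hp.pos k)
  have h2 := (ZMod.natCast_eq_natCast_iff' _ _ _).1 h
  rw [Nat.mod_eq_of_lt (h1 i hi), Nat.mod_eq_of_lt (h1 i' hi')] at h2
  exact Nat.eq_of_mul_eq_mul_left (pow_pos hp.pos k) h2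

theorem zmodPowCast_eq_iff (hp : p.Prime) {s a : ZMod (p ^ (k + 1))} :
    zmodPowCast p k s = zmodPowCast p k a ↔
      ∃ i ∈ range p, s = a - ((p ^ k * i : ℕ) : ZMod (p ^ (k + 1))) := by
  have : NeZero p := ⟨hp.ne_zero⟩
  constructor
  · intro h
    have h1 : ((a - s).val : ZMod (p ^ k)) = 0 := by
      have := map_natCast (zmodPowCast p k) (a - s).val
      rw [ZMod.natCast_zmod_val, map_sub, h, sub_self] at this
      exact this.symm
    obtain ⟨i, hi⟩ := (ZMod.natCast_eq_zero_iff _ _).1 h1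
    refine ⟨i, mem_range.2 ?_, ?_⟩
    · have h2 := ZMod.val_lt (a - s)
      rw [hi, pow_succ] at h2
      exact Nat.lt_of_mul_lt_mul_left h2
    · rw [← hi, ZMod.natCast_zmod_val, sub_sub_cancel]
  · rintro ⟨i, -, rfl⟩
    rw [map_sub, Nat.cast_mul, map_mul, zmodPowCast_pow, zero_mul, sub_zero]

theorem filter_zmodPowCast_eq (hp : p.Prime) [NeZero p] (a : ZMod (p ^ (k + 1))) :
    ({s | zmodPowCast p k s = zmodPowCast p k a} : Finset (ZMod (p ^ (k + 1)))) =
      (range p).image fun i => a - ((p ^ k * i : ℕ) : ZMod (p ^ (k + 1))) := by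
  ext s
  rw [mem_filter, mem_image, zmodPowCast_eq_iff hp]
  simp [eq_comm]

theorem sub_natCast_pow_mul_injOn (hp : p.Prime) (a : ZMod (p ^ (k + 1))) :
    Set.InjOn (fun i : ℕ => a - ((p ^ k * i : ℕ) : ZMod (p ^ (k + 1)))) (range p) :=
  fun _ hi _ hi' h => natCast_pow_mul_injOn hp hi hi' (sub_right_injective h)

/-- Every nontrivial subgroup of `ℤ/p^(k+1)` contains the one generated by `p^k`. Concretely, `gcd
(l, p^(k+1)) = p^r` with `r ≤ k`, and a Bézout coefficient times `p^(k-r)` serves as `u`. -/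
theorem exists_mul_eq_pow (hp : p.Prime) {l : ℕ} (hl : ¬ p ^ (k + 1) ∣ l) :
    ∃ u : ℕ, ((u * l : ℕ) : ZMod (p ^ (k + 1))) = ((p ^ k : ℕ) : ZMod (p ^ (k + 1))) := by
  have : NeZero p := ⟨hp.ne_zero⟩
  obtain ⟨r, hr, hrg⟩ := (Nat.dvd_prime_pow hp).1 (Nat.gcd_dvd_right l (p ^ (k + 1)))
  have hrk : r ≤ k := by
    by_contra h
    have : r = k + 1 := by omega
    rw [this] at hrg
    exact hl (hrg ▸ Nat.gcd_dvd_left l (p ^ (k + 1)))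
  have h1 := congrArg (Int.cast : ℤ → ZMod (p ^ (k + 1))) (Nat.gcd_eq_gcd_ab l (p ^ (k + 1)))
  rw [hrg] at h1
  push_cast at h1
  have h0 : ((p : ZMod (p ^ (k + 1))) ^ (k + 1)) = 0 := by exact_mod_cast ZMod.natCast_self _
  rw [h0, zero_mul, add_zero] at h1
  refine ⟨((p : ZMod (p ^ (k + 1))) ^ (k - r) * (l.gcdA (p ^ (k + 1)) : ZMod _)).val, ?_⟩
  rw [Nat.cast_mul, ZMod.natCast_zmod_val, mul_assoc, mul_comm (Int.cast (l.gcdA (p ^ (k + 1)))), ← h1, ← pow_add,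
    Nat.sub_add_cancel hrk, Nat.cast_pow]

end CyclicGroupLattice

/-! ### Lattices over rings of integers. -/

section CyclotomicModule

open NumberField

variable {K : Type*} [Field K] [NumberField K] {L : Type*} [AddCommGroup L] [Module (𝓞 K) L]

/-- The norm of the ideal `(o)` is a multiple of `o`, so an element killed by `o ≠ 0` is killed by a
nonzero integer. -/
theorem isTorsionFree_ringOfIntegers [Module.IsTorsionFree ℤ L] :
    Module.IsTorsionFree (𝓞 K) L := by
  refine Module.IsTorsionFree.of_smul_eq_zero fun o x h => ?_
  by_contra! hne
  have h1 := Ideal.absNorm_mem (Ideal.span {o})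
  obtain ⟨o', ho'⟩ := Ideal.mem_span_singleton'.1 h1
  have h2 : (Ideal.absNorm (Ideal.span {o}) : ℤ) • x = 0 := by
    have : ((Ideal.absNorm (Ideal.span {o}) : ℕ) : 𝓞 K) • x = 0 := by
      rw [← ho', mul_smul, h, smul_zero]
    rw [Nat.cast_smul_eq_nsmul] at this
    rwa [natCast_zsmul]
  rcases smul_eq_zero.1 h2 with h3 | h3
  · have h4 : Ideal.absNorm (Ideal.span {o}) = 0 := by exact_mod_cast h3
    rw [Ideal.absNorm_eq_zero_iff, Ideal.span_singleton_eq_bot] at h4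
    exact hne.1 h4
  · exact hne.2 h3

/-- Over a Dedekind domain torsion-free implies flat, and a finitely presented flat module is
projective. -/
theorem exists_retract_ringOfIntegers [Module.IsTorsionFree ℤ L] [Module.Finite ℤ L] :
    ∃ (n : ℕ) (f : (Fin n → 𝓞 K) →ₗ[𝓞 K] L) (g : L →ₗ[𝓞 K] (Fin n → 𝓞 K)),
      f ∘ₗ g = LinearMap.id := by
  have := isTorsionFree_ringOfIntegers (K := K) (L := L)
  have : Module.Finite (𝓞 K) L := Module.Finite.of_restrictScalars_finite ℤ (𝓞 K) L
  have : Module.FinitePresentation (𝓞 K) L := Module.finitePresentation_of_finite _ _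
  have : Module.Projective (𝓞 K) L := Module.Flat.projective_of_finitePresentation
  obtain ⟨n, f, g, -, -, h⟩ := Module.Finite.exists_comp_eq_id_of_projective (𝓞 K) L
  exact ⟨n, f, g, h⟩

end CyclotomicModule

/-! ### The ring of integers `ℤ[ζ]` as a sublattice of the regular representation. -/

section CyclotomicAction

open NumberField Polynomial

variable {p k : ℕ} {K : Type*} [Field K] [NumberField K] [NeZero p]
  [IsCyclotomicExtension {p ^ (k + 1)} ℚ K] {ζ : K} (hζ : IsPrimitiveRoot ζ (p ^ (k + 1)))

theorem aeval_minpoly_toInteger_eq_zero (hp : p.Prime) {L : Type*} [AddCommGroup L]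
    {t : Module.End ℤ L} (ht : ∑ i ∈ range p, (t ^ p ^ k) ^ i = 0) :
    aeval t (minpoly ℤ hζ.integralPowerBasis.gen) = 0 := by
  have h1 : minpoly ℤ hζ.integralPowerBasis.gen = cyclotomic (p ^ (k + 1)) ℤ := by
    rw [hζ.integralPowerBasis_gen, cyclotomic_eq_minpoly hζ (NeZero.pos _)]
    exact (RingOfIntegers.minpoly_coe hζ.toInteger).symm
  rw [h1, cyclotomic_prime_pow_eq_geom_sum hp]
  simpa using ht

/-- An endomorphism annihilated by the cyclotomic polynomial makes a module over the ring of
integers of the cyclotomic field. -/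
theorem exists_cyclotomic_action (hp : p.Prime) {L : Type*} [AddCommGroup L]
    {t : Module.End ℤ L} (ht : ∑ i ∈ range p, (t ^ p ^ k) ^ i = 0) :
    ∃ _ : Module (𝓞 K) L, ∀ x, hζ.toInteger • x = t x := by
  let φ := hζ.integralPowerBasis.lift t (aeval_minpoly_toInteger_eq_zero hζ hp ht)
  refine ⟨Module.compHom L φ.toRingHom, fun x => ?_⟩
  change φ hζ.toInteger x = t x
  rw [← hζ.integralPowerBasis_gen, PowerBasis.lift_gen]

/-- The shift on functions on `ℤ/p^(k+1)`. -/
def zmodShift (N : ℕ) : Module.End ℤ (ZMod N → ℤ) :=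
  LinearMap.funLeft ℤ ℤ fun s => s - 1

theorem zmodShift_pow_apply (N n : ℕ) (v : ZMod N → ℤ) (s : ZMod N) :
    (zmodShift N ^ n) v s = v (s - n) := by
  induction n generalizing s with
  | zero => simp
  | succ n ih =>
    rw [pow_succ', Module.End.mul_apply]
    change (zmodShift N ^ n) v (s - 1) = _
    rw [ih, Nat.cast_succ, sub_sub, add_comm]

/-- The functions on `ℤ/p^(k+1)` whose sums over the fibres of `ℤ/p^(k+1) → ℤ/p^k` vanish. -/
def fibreSumKer (p k : ℕ) [NeZero p] : Submodule ℤ (ZMod (p ^ (k + 1)) → ℤ) where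
  carrier := {v | ∀ x, ∑ s with zmodPowCast p k s = x, v s = 0}
  add_mem' hv hw x := by simp [sum_add_distrib, hv x, hw x]
  zero_mem' x := by simp
  smul_mem' c v hv x := by simp [← mul_sum, hv x]

theorem mem_fibreSumKer_iff (hp : p.Prime) {v : ZMod (p ^ (k + 1)) → ℤ} :
    v ∈ fibreSumKer p k ↔ ∀ a, ∑ i ∈ range p, v (a - ((p ^ k * i : ℕ) : ZMod (p ^ (k + 1)))) = 0 := by
  change (∀ x, ∑ s with zmodPowCast p k s = x, v s = 0) ↔ _
  rw [(zmodPowCast_surjective p k).forall]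
  refine forall_congr' fun a => ?_
  rw [filter_zmodPowCast_eq hp, sum_image (sub_natCast_pow_mul_injOn hp a)]

theorem zmodShift_mem_fibreSumKer (hp : p.Prime) {v : ZMod (p ^ (k + 1)) → ℤ}
    (hv : v ∈ fibreSumKer p k) : zmodShift _ v ∈ fibreSumKer p k := by
  rw [mem_fibreSumKer_iff hp] at hv ⊢
  intro a
  rw [← hv (a - 1)]
  exact sum_congr rfl fun i _ => congrArg v (sub_right_comm _ _ _)

/-- Two points of one fibre differ by a multiple of `p^k`, so differences of their delta functions
telescope from the given ones. A function with zero fibre sums is a combination of differences with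
a base point in each fibre. -/
theorem fibreSumKer_le (hp : p.Prime) {R : Submodule ℤ (ZMod (p ^ (k + 1)) → ℤ)}
    (hR : ∀ s : ZMod (p ^ (k + 1)),
      (Pi.single s 1 - Pi.single (s + (p ^ k : ℕ)) 1 : ZMod (p ^ (k + 1)) → ℤ) ∈ R) :
    fibreSumKer p k ≤ R := by
  have h1 : ∀ (i : ℕ) (s : ZMod (p ^ (k + 1))),
      (Pi.single s 1 - Pi.single (s - (p ^ k * i : ℕ)) 1 : ZMod (p ^ (k + 1)) → ℤ) ∈ R := by
    intro i s
    induction i with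
    | zero => simp
    | succ i ih =>
      have h2 := R.sub_mem ih (hR (s - (p ^ k * (i + 1) : ℕ)))
      have h3 : s - ((p ^ k * (i + 1) : ℕ) : ZMod (p ^ (k + 1))) + (p ^ k : ℕ) =
          s - ((p ^ k * i : ℕ) : ZMod (p ^ (k + 1))) := by
        push_cast; ring
      rw [h3] at h2
      convert h2 using 1
      abel
  intro v hv
  obtain ⟨z, hz⟩ := (zmodPowCast_surjective p k).hasRightInverse
  have h2 : ∀ s : ZMod (p ^ (k + 1)), (Pi.single (z (zmodPowCast p k s)) 1 - Pi.single s 1 :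
      ZMod (p ^ (k + 1)) → ℤ) ∈ R := by
    intro s
    obtain ⟨i, -, hi⟩ := (zmodPowCast_eq_iff hp).1 (hz (zmodPowCast p k s)).symm
    have := h1 i (z (zmodPowCast p k s))
    rwa [← hi] at this
  have h3 : ∑ s, v s • (Pi.single (z (zmodPowCast p k s)) 1 : ZMod (p ^ (k + 1)) → ℤ) = 0 := by
    rw [← sum_fiberwise_of_maps_to (g := zmodPowCast p k) (t := univ) fun _ _ => mem_univ _]
    refine sum_eq_zero fun x _ => ?_
    have : ∀ s ∈ ({s | zmodPowCast p k s = x} : Finset (ZMod (p ^ (k + 1)))),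
        v s • (Pi.single (z (zmodPowCast p k s)) 1 : ZMod (p ^ (k + 1)) → ℤ) =
          v s • Pi.single (z x) 1 := fun s hs => by rw [(mem_filter.1 hs).2]
    rw [sum_congr rfl this, ← sum_smul, hv x, zero_smul]
  have h4 : v = ∑ s, v s • (Pi.single s 1 : ZMod (p ^ (k + 1)) → ℤ) := by
    funext a
    simp [Finset.sum_apply, Pi.single_apply]
  have h5 := R.neg_mem (R.sum_mem fun s (_ : s ∈ univ) => R.smul_mem (v s) (h2 s))
  simp only [smul_sub, sum_sub_distrib] at h5
  rwa [h3, ← h4, zero_sub, neg_neg] at h5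

/-- The ring of integers of the cyclotomic field as the lattice `fibreSumKer`. -/
theorem exists_ringOfIntegers_embedding (hp : p.Prime) :
    ∃ κ : 𝓞 K →ₗ[ℤ] (ZMod (p ^ (k + 1)) → ℤ), Function.Injective κ ∧
      LinearMap.range κ = fibreSumKer p k ∧
      ∀ o, κ (hζ.toInteger * o) = zmodShift _ (κ o) := by
  let T : Module.End ℤ (fibreSumKer p k) :=
    (zmodShift _).restrict fun v hv => zmodShift_mem_fibreSumKer hp hv
  have hTpow : ∀ (n : ℕ) v, ((T ^ n) v : ZMod (p ^ (k + 1)) → ℤ) = (zmodShift _ ^ n) v.1 := by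
    intro n v
    induction n with
    | zero => rfl
    | succ n ih =>
      rw [pow_succ' T, pow_succ' (zmodShift _), Module.End.mul_apply, Module.End.mul_apply, ← ih]
      rfl
  have hT : ∑ i ∈ range p, (T ^ p ^ k) ^ i = 0 := by
    refine LinearMap.ext fun v => Subtype.ext (funext fun s => ?_)
    rw [LinearMap.sum_apply, Submodule.coe_sum, Finset.sum_apply, LinearMap.zero_apply,
      Submodule.coe_zero, Pi.zero_apply, ← (mem_fibreSumKer_iff hp).1 v.2 s]
    refine sum_congr rfl fun i _ => ?_
    rw [← pow_mul, hTpow, zmodShift_pow_apply]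
  obtain ⟨_, hact⟩ := exists_cyclotomic_action hζ hp hT
  have hfree := isTorsionFree_ringOfIntegers (K := K) (L := fibreSumKer p k)
  -- The lattice `fibreSumKer` is itself a torsion-free `ℤ[ζ]`-module, because the norm of the
  -- subgroup of order `p` is the fibre sum. It is free of rank one on this `v`, whose translates by
  -- powers of `ζ` are the generators in `fibreSumKer_le`.
  let v : ZMod (p ^ (k + 1)) → ℤ := Pi.single 0 1 - Pi.single ((p ^ k : ℕ) : ZMod (p ^ (k + 1))) 1
  have hne : (0 : ZMod (p ^ (k + 1))) ≠ ((p ^ k : ℕ) : ZMod (p ^ (k + 1))) := by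
    intro h
    have := Nat.le_of_dvd (pow_pos hp.pos k) ((ZMod.natCast_eq_zero_iff _ _).1 h.symm)
    exact absurd this (not_le.2 (Nat.pow_lt_pow_right hp.one_lt k.lt_succ_self))
  have hv : v ∈ fibreSumKer p k := by
    intro x
    simp only [v, Pi.sub_apply, sum_sub_distrib, Pi.single_apply, sum_ite_eq', mem_filter, mem_univ,
      true_and, map_zero, zmodPowCast_pow, sub_self]
  let v' : fibreSumKer p k := ⟨v, hv⟩
  have hv' : v' ≠ 0 := fun h => by
    have h0 : v 0 = 0 := congrFun (congrArg Subtype.val h) 0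
    simp only [v, Pi.sub_apply, Pi.single_eq_same, Pi.single_eq_of_ne hne, sub_zero] at h0
    exact one_ne_zero h0
  let κ : 𝓞 K →ₗ[ℤ] (ZMod (p ^ (k + 1)) → ℤ) :=
    (fibreSumKer p k).subtype ∘ₗ ((LinearMap.toSpanSingleton (𝓞 K) _ v').restrictScalars ℤ)
  have hκ : ∀ o, κ o = ((o • v' : fibreSumKer p k) : ZMod (p ^ (k + 1)) → ℤ) := fun o => rfl
  have hshift : ∀ o, κ (hζ.toInteger * o) = zmodShift _ (κ o) := fun o => by
    rw [hκ, mul_smul, hact]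
    rfl
  have hpow : ∀ n : ℕ, κ (hζ.toInteger ^ n) = (zmodShift _ ^ n) v := by
    intro n
    induction n with
    | zero => rw [pow_zero, hκ, one_smul]; rfl
    | succ n ih => rw [pow_succ' hζ.toInteger, hshift, ih, pow_succ' (zmodShift _), Module.End.mul_apply]
  refine ⟨κ, fun o o' h => ?_, le_antisymm ?_ (fibreSumKer_le hp fun s => ?_), hshift⟩
  · have h1 : (o - o') • v' = 0 := by
      rw [sub_smul, sub_eq_zero]
      exact Subtype.ext h
    exact sub_eq_zero.1 ((smul_eq_zero.1 h1).resolve_right hv')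
  · rintro _ ⟨o, rfl⟩
    exact (o • v').2
  · refine ⟨hζ.toInteger ^ s.val, ?_⟩
    rw [hpow]
    funext a
    rw [zmodShift_pow_apply, ZMod.natCast_zmod_val]
    have h1 : a - s = 0 ↔ a = s := sub_eq_zero
    have h2 : a - s = ((p ^ k : ℕ) : ZMod (p ^ (k + 1))) ↔ a = s + (p ^ k : ℕ) := sub_eq_iff_eq_add'
    simp only [v, Pi.sub_apply, Pi.single_apply, h1, h2]

end CyclotomicAction

/-! ### The prime-power case, and the general case by Sylow reduction. -/

section PrimePower

open NumberField

variable {p k : ℕ}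

theorem card_filter_zmodPowCast (hp : p.Prime) [NeZero p] (x : ZMod (p ^ k)) :
    #{s | zmodPowCast p k s = x} = p := by
  obtain ⟨a, rfl⟩ := zmodPowCast_surjective p k x
  rw [filter_zmodPowCast_eq hp, card_image_of_injOn (sub_natCast_pow_mul_injOn hp a), card_range]

/-- The fibration of the free `ℤ/p^(k+1)`-set of rank `n` over its quotient by the subgroup of
order `p`. -/
def freeSetProj (n p k : ℕ) (s : Fin n × ZMod (p ^ (k + 1))) : Fin n × ZMod (p ^ k) :=
  (s.1, zmodPowCast p k s.2)

/-- The translation by `1` on the free `ℤ/N`-set of rank `n`. -/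
def freeSetShift (n N : ℕ) : Equiv.Perm (Fin n × ZMod N) :=
  Equiv.prodCongr (Equiv.refl _) (Equiv.addRight 1)

theorem freeSetShift_pow_apply (n N l : ℕ) (s : Fin n × ZMod N) :
    (freeSetShift n N ^ l) s = (s.1, s.2 + l) := by
  induction l with
  | zero => simp
  | succ l ih =>
    rw [pow_succ', Equiv.Perm.mul_apply, ih, Nat.cast_succ, ← add_assoc]
    rfl

theorem sum_filter_freeSetProj {M : Type*} [AddCommMonoid M] [NeZero p] {n : ℕ}
    (x : Fin n × ZMod (p ^ k)) (v : Fin n × ZMod (p ^ (k + 1)) → M) :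
    ∑ s with freeSetProj n p k s = x, v s = ∑ s with zmodPowCast p k s = x.2, v (x.1, s) := by
  refine (sum_nbij' (fun s => (x.1, s)) Prod.snd ?_ ?_ ?_ ?_ ?_).symm
  · intro s hs
    simpa [freeSetProj, Prod.ext_iff] using hs
  · intro s hs
    have : freeSetProj n p k s = x := by simpa using hs
    simp [← this, freeSetProj]
  · intro s _
    rfl
  · intro s hs
    have : freeSetProj n p k s = x := by simpa using hs
    rw [← this]
    rfl
  · intro s _
    rfl

/-- If `l` acts nontrivially and stabilises `T`, then translation by `p^k`, which is a multiple of
`l`, maps `T` into itself. Its orbits are the full fibres, of size `p`. -/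
theorem dvd_of_map_freeSetShift_pow_eq (hp : p.Prime) [NeZero p] {n : ℕ}
    {T : Finset (Fin n × ZMod (p ^ (k + 1)))} (hT : T.Nonempty)
    (hfib : ∀ x, fibreCard (freeSetProj n p k) T x < p) {l : ℕ}
    (hl : T.map (freeSetShift n (p ^ (k + 1)) ^ l : Equiv.Perm _).toEmbedding = T) :
    p ^ (k + 1) ∣ l := by
  by_contra hdvd
  obtain ⟨u, hu⟩ := exists_mul_eq_pow hp hdvd
  have h1 : ∀ (i : ℕ), ∀ s ∈ T, (s.1, s.2 + ((i * l : ℕ) : ZMod (p ^ (k + 1)))) ∈ T := by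
    intro i
    induction i with
    | zero => intro s hs; simpa using hs
    | succ i ih =>
      intro s hs
      have h2 := mem_map_of_mem (freeSetShift n (p ^ (k + 1)) ^ l : Equiv.Perm _).toEmbedding
        (ih s hs)
      rw [hl] at h2
      have h3 := freeSetShift_pow_apply n (p ^ (k + 1)) l
        (s.1, s.2 + ((i * l : ℕ) : ZMod (p ^ (k + 1))))
      rw [Equiv.coe_toEmbedding, h3] at h2
      convert h2 using 2
      push_cast
      ring
  have h2 : ∀ (i : ℕ), ∀ s ∈ T, (s.1, s.2 + ((p ^ k * i : ℕ) : ZMod (p ^ (k + 1)))) ∈ T := by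
    intro i s hs
    have := h1 (i * u) s hs
    rwa [mul_assoc, Nat.cast_mul, hu, ← Nat.cast_mul, mul_comm] at this
  obtain ⟨s, hs⟩ := hT
  have h3 : p ≤ fibreCard (freeSetProj n p k) T (freeSetProj n p k s) := by
    refine (card_range p).symm.le.trans (card_le_card_of_injOn
      (fun i => (s.1, s.2 + ((p ^ k * i : ℕ) : ZMod (p ^ (k + 1))))) (fun i _ => ?_) ?_)
    · rw [mem_coe, mem_filter]
      refine ⟨h2 i s hs, ?_⟩
      simp only [freeSetProj, map_add]
      rw [Nat.cast_mul, map_mul, zmodPowCast_pow, zero_mul, add_zero]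
    · intro i hi i' hi' h
      exact natCast_pow_mul_injOn hp hi hi' (add_left_cancel (congrArg Prod.snd h))
  exact absurd (hfib _) (not_lt.2 h3)

theorem tateVanishes_exteriorPower_ringOfIntegers (hp : p.Prime) [NeZero p] {K : Type*} [Field K]
    [NumberField K] [IsCyclotomicExtension {p ^ (k + 1)} ℚ K] {ζ : K}
    (hζ : IsPrimitiveRoot ζ (p ^ (k + 1))) (n j : ℕ) :
    TateVanishes (ExteriorAlgebra.map (DistribSMul.toLinearMap ℤ (Fin n → 𝓞 K)
      hζ.toInteger)).toLinearMap (p ^ (k + 1)) j (⋀[ℤ]^j (Fin n → 𝓞 K)) := by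
  obtain ⟨κ, hκ, hrange, hshift⟩ := exists_ringOfIntegers_embedding hζ hp
  let _ : LinearOrder (Fin n × ZMod (p ^ (k + 1))) :=
    LinearOrder.lift' (Fintype.equivFin _) (Fintype.equivFin _).injective
  let i : (Fin n → 𝓞 K) →ₗ[ℤ] (Fin n × ZMod (p ^ (k + 1)) → ℤ) :=
    LinearMap.pi fun s => LinearMap.proj s.2 ∘ₗ κ ∘ₗ LinearMap.proj s.1
  have hi : ∀ o s, i o s = κ (o s.1) s.2 := fun _ _ => rfl
  obtain ⟨z, hz⟩ := (zmodPowCast_surjective p k).hasRightInverse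
  let f : Module.End ℤ (Fin n × ZMod (p ^ (k + 1)) → ℤ) :=
    LinearMap.funLeft ℤ ℤ (freeSetShift n (p ^ (k + 1))).symm
  have hfs : ∀ x (v : Fin n × ZMod (p ^ (k + 1)) → ℤ),
      fibreSum (freeSetProj n p k) (Pi.basisFun ℤ _) x v =
        ∑ s with zmodPowCast p k s = x.2, v (x.1, s) := by
    intro x v
    rw [← sum_filter_freeSetProj]
    simp [fibreSum, LinearMap.sum_apply]
  refine tateVanishes_exteriorPower_of_fibreSum (p := p) (π := freeSetProj n p k)
    (b := Pi.basisFun ℤ _) (τ := freeSetShift n (p ^ (k + 1))) (σ := freeSetShift n (p ^ k))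
    (f := f) (i := i) (z := fun x => (x.1, z x.2)) (fun s => ?_) (fun s => ?_) (fun x => ?_)
    (pow_pos hp.pos _).ne' ?_ (fun x => ?_)
    (fun T hT hfib l hl => dvd_of_map_freeSetShift_pow_eq hp hT hfib hl) ?_ (fun v => ?_)
    (fun o => ?_) j
  · refine Prod.ext rfl ?_
    change zmodPowCast p k (s.2 + 1) = zmodPowCast p k s.2 + 1
    rw [map_add, map_one]
  · rw [Pi.basisFun_apply, Pi.basisFun_apply]
    funext a
    change (Pi.single s 1 : _ → ℤ) ((freeSetShift n (p ^ (k + 1))).symm a) = _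
    simp only [Pi.single_apply, Equiv.symm_apply_eq]
  · exact Prod.ext rfl (hz x.2)
  · refine Equiv.ext fun s => ?_
    rw [freeSetShift_pow_apply, ZMod.natCast_self, add_zero]
    rfl
  · have := sum_filter_freeSetProj (M := ℕ) x fun _ => 1
    rw [← card_eq_sum_ones, ← card_eq_sum_ones, card_filter_zmodPowCast hp] at this
    exact this
  · intro o o' h
    funext a
    exact hκ (funext fun s => congrFun h (a, s))
  · simp only [hfs]
    have h1 : (∀ x : Fin n × ZMod (p ^ k), ∑ s with zmodPowCast p k s = x.2, v (x.1, s) = 0) ↔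
        ∀ a, (fun s => v (a, s)) ∈ fibreSumKer p k :=
      ⟨fun h a x => h (a, x), fun h x => h x.1 x.2⟩
    rw [h1, ← hrange]
    constructor
    · rintro ⟨o, rfl⟩ a
      exact ⟨o a, rfl⟩
    · intro h
      choose o ho using h
      exact ⟨o, funext fun s => congrFun (ho s.1) s.2⟩
  · funext s
    have h1 : (freeSetShift n (p ^ (k + 1))).symm s = (s.1, s.2 - 1) := by
      rw [Equiv.symm_apply_eq]
      exact Prod.ext rfl (sub_add_cancel _ _).symm
    change κ (hζ.toInteger * o s.1) s.2 = i o ((freeSetShift n (p ^ (k + 1))).symm s)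
    rw [h1, hi, hshift]
    rfl

theorem map_map_exteriorAlgebra {M N P : Type*} [AddCommGroup M] [AddCommGroup N] [AddCommGroup P]
    (u : M →ₗ[ℤ] N) (v : N →ₗ[ℤ] P) (w : ExteriorAlgebra ℤ M) :
    ExteriorAlgebra.map v (ExteriorAlgebra.map u w) = ExteriorAlgebra.map (v ∘ₗ u) w := by
  rw [← ExteriorAlgebra.map_comp_map]
  rfl

theorem exists_cyclotomic_numberField (N : ℕ) [NeZero N] :
    ∃ (K : Type) (_ : Field K) (_ : NumberField K), IsCyclotomicExtension {N} ℚ K := by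
  refine ⟨CyclotomicField N ℚ, inferInstance, inferInstance, ?_⟩
  have h := CyclotomicField.isCyclotomicExtension N ℚ
  -- The two `ℚ`-algebra structures on the cyclotomic field coincide, since such a structure is
  -- unique.
  have e : CyclotomicField.algebra N ℚ = DivisionRing.toRatAlgebra := Subsingleton.elim _ _
  rw [e] at h
  exact h

theorem tateVanishes_exteriorPower_of_primePow (hp : p.Prime) {L : Type*} [AddCommGroup L]
    [Module.IsTorsionFree ℤ L] [Module.Finite ℤ L] {t : Module.End ℤ L}
    (ht : ∑ i ∈ range p, (t ^ p ^ k) ^ i = 0) (j : ℕ) :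
    TateVanishes (ExteriorAlgebra.map t).toLinearMap (p ^ (k + 1)) j (⋀[ℤ]^j L) := by
  have : NeZero p := ⟨hp.ne_zero⟩
  obtain ⟨K, _, _, _⟩ := exists_cyclotomic_numberField (p ^ (k + 1))
  have hζ := IsCyclotomicExtension.zeta_spec (p ^ (k + 1)) ℚ K
  obtain ⟨_, hact⟩ := exists_cyclotomic_action hζ hp ht
  obtain ⟨n, f, g, hfg⟩ := exists_retract_ringOfIntegers (K := K) (L := L)
  refine (tateVanishes_exteriorPower_ringOfIntegers hp hζ n j).of_retract
    (fun w hw => map_mem_exteriorPower t hw) (fun w hw => map_mem_exteriorPower _ hw)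
    (ExteriorAlgebra.map (g.restrictScalars ℤ)).toLinearMap
    (ExteriorAlgebra.map (f.restrictScalars ℤ)).toLinearMap
    (fun w hw => map_mem_exteriorPower _ hw) (fun w hw => map_mem_exteriorPower _ hw)
    (fun w _ => ?_) (fun w _ => ?_) (fun w _ => ?_)
  · simp only [AlgHom.toLinearMap_apply]
    rw [map_map_exteriorAlgebra, map_map_exteriorAlgebra]
    congr 2
    ext1 x
    exact (congrArg g (hact x).symm).trans (map_smul g _ x)
  · simp only [AlgHom.toLinearMap_apply]
    rw [map_map_exteriorAlgebra, map_map_exteriorAlgebra]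
    congr 2
    refine LinearMap.ext fun x => ?_
    exact (map_smul f _ x).trans (hact (f x))
  · simp only [AlgHom.toLinearMap_apply]
    rw [map_map_exteriorAlgebra]
    have : f.restrictScalars ℤ ∘ₗ g.restrictScalars ℤ = LinearMap.id :=
      LinearMap.ext fun x => congrArg (fun h => h x) hfg
    rw [this, ExteriorAlgebra.map_id]
    rfl

theorem map_pow_toLinearMap {L : Type*} [AddCommGroup L] (t : Module.End ℤ L) (n : ℕ) :
    ((ExteriorAlgebra.map t).toLinearMap : Module.End ℤ (ExteriorAlgebra ℤ L)) ^ n =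
      (ExteriorAlgebra.map (t ^ n)).toLinearMap := by
  induction n with
  | zero =>
    rw [pow_zero, pow_zero]
    exact (congrArg AlgHom.toLinearMap (ExteriorAlgebra.map_id (R := ℤ) (M := L))).symm
  | succ n ih =>
    rw [pow_succ', pow_succ', ih]
    exact congrArg AlgHom.toLinearMap (ExteriorAlgebra.map_comp_map (t ^ n) t)

/-- Vanishing for the exterior powers of a lattice with an action of a cyclic group of order `m`
that is free outside the origin. -/
theorem tateVanishes_exteriorPower {L : Type*} [AddCommGroup L] [Module.IsTorsionFree ℤ L]
    [Module.Finite ℤ L] {t : Module.End ℤ L} {m : ℕ} (hm : m ≠ 0) (ht : t ^ m = 1)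
    (hfree : ∀ n x, (t ^ n) x = x → m ∣ n ∨ x = 0) (j : ℕ) :
    TateVanishes (ExteriorAlgebra.map t).toLinearMap m j (⋀[ℤ]^j L) := by
  refine TateVanishes.of_prime_powers hm (fun w hw => map_mem_exteriorPower t hw)
    fun p hp hpm => ?_
  rw [map_pow_toLinearMap]
  obtain ⟨k, hk⟩ : ∃ k, m.factorization p = k + 1 :=
    Nat.exists_eq_succ_of_ne_zero (hp.factorization_pos_of_dvd hm hpm).ne'
  rw [hk]
  refine tateVanishes_exteriorPower_of_primePow hp ?_ j
  have hmul : m / p ^ (k + 1) * p ^ (k + 1) = m :=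
    Nat.div_mul_cancel (hk ▸ Nat.ordProj_dvd m p)
  set q := m / p ^ (k + 1) with hq
  have hq0 : q ≠ 0 := by
    rintro h
    rw [h, zero_mul] at hmul
    exact hm hmul.symm
  rw [← pow_mul]
  refine LinearMap.ext fun x => ?_
  -- The element `t ^ (q * p ^ k)` generates the subgroup of order `p`, and its norm of `x` is a
  -- fixed vector. As `q * p ^ k < m`, freeness makes this vector zero.
  have h1 : (t ^ (q * p ^ k)) ((∑ i ∈ range p, (t ^ (q * p ^ k)) ^ i) x) =
      (∑ i ∈ range p, (t ^ (q * p ^ k)) ^ i) x := by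
    rw [← sub_eq_zero, sub_sum_pow_apply, ← pow_mul, mul_assoc, ← pow_succ, hmul, ht,
      Module.End.one_apply, sub_self]
  rcases hfree _ _ h1 with h2 | h2
  · have h3 := Nat.le_of_dvd (Nat.mul_pos (Nat.pos_of_ne_zero hq0) (pow_pos hp.pos k)) h2
    rw [← hmul] at h3
    have h4 := Nat.le_of_mul_le_mul_left h3 (Nat.pos_of_ne_zero hq0)
    exact absurd h4 (not_le.2 (Nat.pow_lt_pow_right hp.one_lt k.lt_succ_self))
  · exact h2

end PrimePower

/-! ### From the elementary conditions to Tate cohomology in all degrees. -/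

section TateBridge

open CategoryTheory CategoryTheory.Limits

variable {k G : Type} [CommRing k] [CommGroup G] [Fintype G] (A : Rep k G) (g : G)

theorem isZero_homology_subCompNormHom
    (h : ∀ x : A, A.ρ.norm x = 0 → ∃ y, A.ρ g y - y = x) :
    IsZero (Rep.FiniteCyclicGroup.subCompNormHom A g).homology := by
  rw [← ShortComplex.exact_iff_isZero_homology, ShortComplex.moduleCat_exact_iff]
  intro x hx
  obtain ⟨y, hy⟩ := h x hx
  exact ⟨y, by simpa [Rep.sub_hom, Rep.applyAsHom] using hy⟩

theorem isZero_homology_normHomCompSub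
    (h : ∀ x : A, A.ρ g x = x → ∃ y, A.ρ.norm y = x) :
    IsZero (Rep.FiniteCyclicGroup.normHomCompSub A g).homology := by
  rw [← ShortComplex.exact_iff_isZero_homology, ShortComplex.moduleCat_exact_iff]
  intro x hx
  obtain ⟨y, hy⟩ := h x (by simpa [Rep.sub_hom, Rep.applyAsHom, sub_eq_zero] using hx)
  exact ⟨y, hy⟩

/-- Degrees `0` and `-1` are read off the Tate complex directly, since the comparison with group
cohomology and homology is used only in nonzero degrees of the latter. -/
theorem isZero_tateCohomology_zero
    (h : ∀ x : A, A.ρ g x = x → ∃ y, A.ρ.norm y = x) :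
    IsZero (tateCohomology A 0) := by
  change IsZero ((tateComplex A).homology 0)
  rw [← HomologicalComplex.exactAt_iff_isZero_homology,
    HomologicalComplex.exactAt_iff' _ (-1) 0 1 (by simp) (by simp),
    ShortComplex.moduleCat_exact_iff]
  intro x hx
  change (groupCohomology.inhomogeneousCochains A).X 0 at x
  change ((groupCohomology.inhomogeneousCochains A).d 0 1).hom x = 0 at hx
  have h1 : groupCohomology.d₀₁ A ((groupCohomology.cochainsIso₀ A).hom x) = 0 := by
    rw [← ConcreteCategory.comp_apply, groupCohomology.comp_d₀₁_eq, ConcreteCategory.comp_apply]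
    erw [hx]
    exact map_zero _
  obtain ⟨y, hy⟩ := h ((groupCohomology.cochainsIso₀ A).hom x)
    (sub_eq_zero.mp (congrFun h1 g))
  refine ⟨(groupHomology.chainsIso₀ A).inv y, ?_⟩
  change A.tateNorm ((groupHomology.chainsIso₀ A).inv y) = x
  rw [Rep.tateNorm, ConcreteCategory.comp_apply, ConcreteCategory.comp_apply, Iso.inv_hom_id_apply]
  change (groupCohomology.cochainsIso₀ A).inv (A.ρ.norm y) = x
  rw [hy, Iso.hom_inv_id_apply]

theorem isZero_tateCohomology_neg_one
    (h : ∀ x : A, A.ρ.norm x = 0 → ∃ y, A.ρ g y - y = x) :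
    IsZero (tateCohomology A (-1)) := by
  change IsZero ((tateComplex A).homology (-1))
  rw [← HomologicalComplex.exactAt_iff_isZero_homology,
    HomologicalComplex.exactAt_iff' _ (-2) (-1) 0 (by simp) (by simp),
    ShortComplex.moduleCat_exact_iff]
  intro x hx
  change (groupHomology.inhomogeneousChains A).X 0 at x
  change A.tateNorm x = 0 at hx
  rw [Rep.tateNorm, ConcreteCategory.comp_apply, ConcreteCategory.comp_apply] at hx
  obtain ⟨y, hy⟩ := h ((groupHomology.chainsIso₀ A).hom x) (by
    have := congrArg (groupCohomology.cochainsIso₀ A).hom hx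
    rw [Iso.inv_hom_id_apply, map_zero] at this
    exact this)
  -- The boundary of a 1-chain at `h` acts through `h⁻¹`, so the chain is placed at `g⁻¹` to produce
  -- `g y - y`.
  refine ⟨(groupHomology.chainsIso₁ A).inv (Finsupp.single g⁻¹ y), ?_⟩
  change ((groupHomology.inhomogeneousChains A).d 1 0)
    ((groupHomology.chainsIso₁ A).inv (Finsupp.single g⁻¹ y)) = x
  rw [← ConcreteCategory.comp_apply, groupHomology.eq_d₁₀_comp_inv, ConcreteCategory.comp_apply,
    groupHomology.d₁₀_single, inv_inv, hy, Iso.hom_inv_id_apply]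

theorem isZero_tateCohomology_of_even (hg : ∀ x, x ∈ Subgroup.zpowers g)
    (h : ∀ x : A, A.ρ g x = x → ∃ y, A.ρ.norm y = x) {i : ℤ} (hi : Even i) :
    IsZero (tateCohomology A i) := by
  classical
  rcases lt_trichotomy i 0 with h0 | rfl | h0
  -- Tate cohomology in degree `-(n + 1)` is homology in degree `n`, so the parity flips.
  · obtain ⟨n, rfl⟩ : ∃ n : ℕ, i = -(n + 1) := ⟨(-i - 1).toNat, by omega⟩
    have hn : Odd n := by
      rw [Int.even_iff] at hi
      rw [Nat.odd_iff]
      omega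
    have : NeZero n := ⟨hn.pos.ne'⟩
    exact (isZero_homology_normHomCompSub A g h).of_iso
      ((TateCohomology.isoGroupHomology _ n rfl).app A ≪≫
        Rep.FiniteCyclicGroup.groupHomologyIsoOdd A g hg n hn)
  · exact isZero_tateCohomology_zero A g h
  · lift i to ℕ using h0.le
    have : NeZero i := ⟨by rintro rfl; simp at h0⟩
    exact (isZero_homology_normHomCompSub A g h).of_iso
      ((TateCohomology.isoGroupCohomology i).app A ≪≫
        Rep.FiniteCyclicGroup.groupCohomologyIsoEven A g hg i (by exact_mod_cast hi))

theorem isZero_tateCohomology_of_odd (hg : ∀ x, x ∈ Subgroup.zpowers g)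
    (h : ∀ x : A, A.ρ.norm x = 0 → ∃ y, A.ρ g y - y = x) {i : ℤ} (hi : Odd i) :
    IsZero (tateCohomology A i) := by
  classical
  rcases lt_trichotomy i (-1) with h0 | rfl | h0
  · obtain ⟨n, rfl⟩ : ∃ n : ℕ, i = -(n + 1) := ⟨(-i - 1).toNat, by omega⟩
    have hn : Even n := by
      rw [Int.odd_iff] at hi
      rw [Nat.even_iff]
      omega
    have : NeZero n := ⟨by rintro rfl; simp at h0⟩
    exact (isZero_homology_subCompNormHom A g h).of_iso
      ((TateCohomology.isoGroupHomology _ n rfl).app A ≪≫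
        Rep.FiniteCyclicGroup.groupHomologyIsoEven A g hg n hn)
  · exact isZero_tateCohomology_neg_one A g h
  · have h1 : 0 ≤ i := by omega
    lift i to ℕ using h1
    have hn : Odd i := by exact_mod_cast hi
    have : NeZero i := ⟨hn.pos.ne'⟩
    exact (isZero_homology_subCompNormHom A g h).of_iso
      ((TateCohomology.isoGroupCohomology i).app A ≪≫
        Rep.FiniteCyclicGroup.groupCohomologyIsoOdd A g hg i hn)

end TateBridge

theorem coe_exteriorPower_apply {k G V : Type*} [CommRing k] [Monoid G] [AddCommGroup V]
    [Module k V] (ρ : Representation k G V) (j : ℕ) (g : G) (w : ⋀[k]^j V) :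
    ((ρ.exteriorPower j g w : ⋀[k]^j V) : ExteriorAlgebra k V) =
      ExteriorAlgebra.map (ρ g) (w : ExteriorAlgebra k V) := by
  have : (⋀[k]^j V).subtype ∘ₗ ρ.exteriorPower j g =
      (ExteriorAlgebra.map (ρ g)).toLinearMap ∘ₗ (⋀[k]^j V).subtype := by
    apply exteriorPower.linearMap_ext
    ext v
    simp [Representation.exteriorPower_apply_ιMulti, exteriorPower.ιMulti_apply_coe,
      ExteriorAlgebra.map_apply_ιMulti, Function.comp_def]
  exact LinearMap.congr_fun this w

theorem sum_eq_sum_range_pow {G M : Type*} [Group G] [Fintype G] [AddCommMonoid M] {g : G}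
    (hg : ∀ x, x ∈ Subgroup.zpowers g) (f : G → M) :
    ∑ x, f x = ∑ i ∈ range (orderOf g), f (g ^ i) := by
  classical
  rw [← IsCyclic.image_range_orderOf hg, sum_image]
  intro a ha b hb hab
  exact pow_injOn_Iio_orderOf (by simpa using ha) (by simpa using hb) hab

theorem coe_norm_exteriorPower_apply {k G V : Type*} [CommRing k] [Group G] [Fintype G]
    [AddCommGroup V] [Module k V] (ρ : Representation k G V) (j : ℕ) {g : G}
    (hg : ∀ x, x ∈ Subgroup.zpowers g) (w : ⋀[k]^j V) :
    (((ρ.exteriorPower j).norm w : ⋀[k]^j V) : ExteriorAlgebra k V) =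
      (∑ i ∈ range (orderOf g), (ExteriorAlgebra.map (ρ g)).toLinearMap ^ i)
        (w : ExteriorAlgebra k V) := by
  rw [Representation.norm, LinearMap.sum_apply, sum_eq_sum_range_pow hg, Submodule.coe_sum,
    LinearMap.sum_apply]
  refine sum_congr rfl fun i hi => ?_
  clear hi
  induction i generalizing w with
  | zero => simp
  | succ i ih =>
    rw [pow_succ, map_mul, Module.End.mul_apply, ih, coe_exteriorPower_apply, pow_succ,
      Module.End.mul_apply]
    rfl

theorem isZero_tateCohomology_exteriorPower {G L : Type} [CommGroup G] [Fintype G] [IsCyclic G]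
    [AddCommGroup L] [Module.IsTorsionFree ℤ L] [Module.Finite ℤ L] (ρ : Representation ℤ G L)
    (hfree : ∀ (g : G) (x : L), ρ g x = x → g = 1 ∨ x = 0)
    (i : ℤ) (j : ℕ) (hij : Odd (i + (j : ℤ))) :
    CategoryTheory.Limits.IsZero (tateCohomology (Rep.of (ρ.exteriorPower j)) i) := by
  obtain ⟨g, hg⟩ := IsCyclic.exists_generator (α := G)
  have key := tateVanishes_exteriorPower (t := ρ g) (m := orderOf g) (orderOf_pos g).ne'
    (by rw [← map_pow, pow_orderOf_eq_one, map_one])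
    (fun n x hx => by
      rw [← map_pow] at hx
      exact (hfree _ _ hx).imp_left orderOf_dvd_of_pow_eq_one) j
  rcases Nat.even_or_odd j with hj | hj
  · refine isZero_tateCohomology_of_odd _ g hg (fun x hx => ?_) ?_
    · change ⋀[ℤ]^j L at x
      change (ρ.exteriorPower j).norm x = 0 at hx
      obtain ⟨y, hy, hyx⟩ := key.1 hj (x : ExteriorAlgebra ℤ L) x.2
        (by rw [← coe_norm_exteriorPower_apply ρ j hg, hx, Submodule.coe_zero])
      refine ⟨(⟨y, hy⟩ : ⋀[ℤ]^j L), ?_⟩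
      change ρ.exteriorPower j g ⟨y, hy⟩ - ⟨y, hy⟩ = x
      apply Subtype.ext
      rw [Submodule.coe_sub, coe_exteriorPower_apply]
      exact hyx
    · have : Even (j : ℤ) := by exact_mod_cast hj
      by_contra h
      rw [Int.not_odd_iff_even] at h
      exact Int.not_even_iff_odd.mpr hij (h.add this)
  · refine isZero_tateCohomology_of_even _ g hg (fun x hx => ?_) ?_
    · change ⋀[ℤ]^j L at x
      change ρ.exteriorPower j g x = x at hx
      obtain ⟨y, hy, hyx⟩ := key.2 hj (x : ExteriorAlgebra ℤ L) x.2
        ((coe_exteriorPower_apply ρ j g x).symm.trans (congrArg Subtype.val hx))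
      refine ⟨(⟨y, hy⟩ : ⋀[ℤ]^j L), ?_⟩
      change (ρ.exteriorPower j).norm ⟨y, hy⟩ = x
      apply Subtype.ext
      rw [coe_norm_exteriorPower_apply ρ j hg]
      exact hyx
    · have : Odd (j : ℤ) := by exact_mod_cast hj
      by_contra h
      rw [Int.not_even_iff_odd] at h
      exact Int.not_even_iff_odd.mpr hij (h.add_odd this)

end

theorem mainTheorem1 {G L : Type} [Group G] [Fintype G] [IsCyclic G]
    [AddCommGroup L] [Module.Free ℤ L] [Module.Finite ℤ L]
    (ρ : Representation ℤ G L)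
    (hfree : ∀ (g : G) (x : L), ρ g x = x → g = 1 ∨ x = 0)
    (i : ℤ) (j : ℕ) (hij : Odd (i + (j : ℤ))) :
    CategoryTheory.Limits.IsZero (tateCohomology (Rep.of (ρ.exteriorPower j)) i) := by
  let _ : CommGroup G := IsCyclic.commGroup
  exact isZero_tateCohomology_exteriorPower ρ hfree i j hij
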